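/- **Notation.** Let $G=(V,E)$ be a finite simple graph with $n=|V|$ and adjacency matrix $\mathbf A$. Bit strings are indexed by $V$; $\oplus$ and $\mathbf A x$ are taken modulo $2$, $1_v$ is the string with a single $1$ at $v$, and $p\cdot p$ is the number of ones of $p$. For operators $M_v$ on subsystem $v$ and a bit string $x$ write $M^x=\bigotimes_v M_v^{x_v}$. Let $X,Z$ be the Pauli matrices, $R_v(\theta)=\cos\theta\,X_v+\sin\theta\,Z_v$, and let $|G\rangle=2^{-n/2}\sum_{x\in\{0,1\}^n}(-1)^{\frac12 x\cdot\mathbf A x}|x\rangle$ be the graph state. A local isometry is an isometry $\Phi=\bigotimes_v\Phi_v$ with each $\Phi_v$ an isometry of the $v$-th subsystem. **Statement.** Let $G$ be a finite simple graph in which every vertex lies in a triangle (for example, a triangular lattice graph), and let $\epsilon>0$. Let $|\psi'\rangle$ be a unit vector in a tensor product of Hilbert spaces indexed by $V$ (of arbitrary dimension), and for each $v$ let $X'_v,Z'_v$ be $\pm1$-valued observables (self-adjoint operators squaring to the identity) on the $v$-th subsystem. Suppose that $$\langle\psi'|X'_vZ'^{\mathbf A1_v}|\psi'\rangle\ge 1-\epsilon\quad\text{for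 every }v\in V,\qquad -\langle\psi'|X'^{\tau}Z'^{\mathbf A\tau}|\psi'\rangle\ge 1-\epsilon$$ for the characteristic vector $\tau$ of every triangle of $G$. For $p\in\{0,1\}^n$ put $$\delta(p)=\left(2\sqrt{p\cdot p}+2\sqrt{2n}+\sqrt{|E|+n}\right)(2\epsilon)^{1/4}.$$ Then there are a local isometry $\Phi$ (whose $v$-th target space is an ancilla space tensored with a qubit) and a unit vector $|junk\rangle$ in the joint ancilla space such that $$\left\|\Phi\left(X'^qZ'^p|\psi'\rangle\right)-|junk\rangle X^qZ^p|G\rangle\right\|\le\delta(p)\qquad\text{for all }p,q\in\{0,1\}^n,$$ and, with the same $\Phi$ and $|junk\rangle$, the following holds for every edge $(u,v)$, every $\theta\in\mathbb R$ and every $\pm1$-valued observable $R'_v(\theta)$ on the $v$-th subsystem: if $$\langle\psi'|R'_v(\theta)\left(\cos\theta\,Z'^{\mathbf A1_v}+\sin\theta\,X'_uZ'^{\mathbf A1_u\oplus1_v}\right)|\psi'\rangle\ge 1-\epsilon,$$ then $$\left\|\Phi\left(R'_v(\theta)|\psi'\rangle\right)-|junk\rangle R_v(\theta)|G\rangle\right\|\le\sqrt{2(\epsilon+2\delta)},\qquad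 \delta=\max\{\delta(\mathbf A1_v),\ \delta(\mathbf A1_u\oplus1_v)\}.$$ -/

import Mathlib

open scoped ENNReal lp Matrix

universe u w

noncomputable section

namespace GraphSelfTest

/-- The Hilbert space `ℓ²(α)` of square-summable complex families indexed by `α`, with
orthonormal basis indexed by `α`. Every complex Hilbert space is unitarily equivalent to one of
this form; `α` finite gives the finite-dimensional spaces. -/
abbrev L2 (α : Type*) : Type _ := lp (fun _ : α => ℂ) 2

/-- The joint space `⨂ v, ℓ²(ι v) = ℓ²(Π v, ι v)` of subsystems `ℓ²(ι v)` labelled by `v`. -/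
abbrev Joint {V : Type*} (ι : V → Type*) : Type _ := L2 (∀ v, ι v)

theorem memL2_iff {α : Type*} {f : α → ℂ} :
    Memℓp f 2 ↔ Summable fun a => ‖f a‖ ^ 2 := by
  rw [memℓp_gen_iff (by norm_num)]
  norm_num

theorem summable_sq {α : Type*} (f : L2 α) : Summable fun a => ‖f a‖ ^ 2 :=
  memL2_iff.1 (lp.memℓp f)

theorem norm_sq_eq_tsum {α : Type*} (f : L2 α) : ‖f‖ ^ 2 = ∑' a, ‖f a‖ ^ 2 := by
  have := lp.norm_rpow_eq_tsum (p := 2) (by norm_num) f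
  norm_num at this
  exact this

section Site

variable {V : Type*} [DecidableEq V] {ι : V → Type*}

/-- The part of a joint vector lying along subsystem `v` when the basis labels of all the other
subsystems are those of `x`. -/
def slice (v : V) (x : ∀ w, ι w) : Joint ι →ₗ[ℂ] L2 (ι v) where
  toFun ψ := ⟨fun j => ψ (Function.update x v j), memL2_iff.2
    ((summable_sq ψ).comp_injective (Function.update_injective x v))⟩
  map_add' _ _ := rfl
  map_smul' _ _ := rfl

@[simp] theorem slice_apply (v : V) (x : ∀ w, ι w) (ψ : Joint ι) (j : ι v) :
    slice v x ψ j = ψ (Function.update x v j) := rfl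

theorem slice_update (v : V) (x : ∀ w, ι w) (j : ι v) (ψ : Joint ι) :
    slice v (Function.update x v j) ψ = slice v x ψ := by
  apply lp.ext
  funext k
  simp

/-- Splitting a joint label into its labels away from `v` and its label at `v`. -/
def splitAt (v : V) : (∀ w : {w // w ≠ v}, ι w) × ι v ≃ (∀ w, ι w) :=
  (Equiv.prodComm _ _).trans (Equiv.piSplitAt v ι).symm

theorem splitAt_eq (v : V) (y : ∀ w : {w // w ≠ v}, ι w) (i j : ι v) :
    splitAt v (y, j) = Function.update (splitAt v (y, i)) v j := by
  funext w
  by_cases hw : w = v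
  · subst hw; simp [splitAt, Equiv.piSplitAt]
  · simp [splitAt, Equiv.piSplitAt, hw]

theorem splitAt_self (v : V) (y : ∀ w : {w // w ≠ v}, ι w) (j : ι v) :
    splitAt v (y, j) v = j := by
  simp [splitAt, Equiv.piSplitAt]

theorem fiber_sum (v : V) (a : (∀ w, ι w) → ℂ) (c : (∀ w : {w // w ≠ v}, ι w) → L2 (ι v))
    (h : ∀ y j, a (splitAt v (y, j)) = c y j) :
    ((Summable fun x => ‖a x‖ ^ 2) ↔ Summable fun y => ‖c y‖ ^ 2) ∧
      ((Summable fun x => ‖a x‖ ^ 2) → ∑' x, ‖a x‖ ^ 2 = ∑' y, ‖c y‖ ^ 2) := by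
  have h1 : (Summable fun x => ‖a x‖ ^ 2) ↔
      Summable fun z : (∀ w : {w // w ≠ v}, ι w) × ι v => ‖c z.1 z.2‖ ^ 2 := by
    rw [← (splitAt v).summable_iff]
    exact summable_congr fun z => by simp only [Function.comp]; rw [h]
  have h2 : ∀ y, ∑' j, ‖c y j‖ ^ 2 = ‖c y‖ ^ 2 := fun y => (norm_sq_eq_tsum _).symm
  constructor
  · rw [h1, summable_prod_of_nonneg (fun _ => by positivity)]
    simp only [h2]
    exact ⟨fun hh => hh.2, fun hh => ⟨fun y => summable_sq _, hh⟩⟩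
  · intro hs
    rw [← (splitAt v).tsum_eq]
    have h3 := (h1.1 hs).tsum_prod
    simp only [h2] at h3
    rw [← h3]
    exact tsum_congr fun z => by rw [h]

theorem hasSum_siteOp (v : V) (M : L2 (ι v) →L[ℂ] L2 (ι v)) (ψ : Joint ι) :
    (Summable fun x : ∀ w, ι w => ‖M (slice v x ψ) (x v)‖ ^ 2) ∧
      ∑' x : ∀ w, ι w, ‖M (slice v x ψ) (x v)‖ ^ 2 ≤ (‖M‖ * ‖ψ‖) ^ 2 := by
  rcases isEmpty_or_nonempty (∀ w, ι w) with hE | ⟨⟨x₀⟩⟩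
  · exact ⟨summable_of_hasFiniteSupport (Set.toFinite _), by rw [tsum_empty]; positivity⟩
  have f1 := fiber_sum v (fun x => ψ x) (fun y => slice v (splitAt v (y, x₀ v)) ψ)
    (fun y j => by rw [splitAt_eq v y (x₀ v) j]; rfl)
  have f2 := fiber_sum v (fun x => M (slice v x ψ) (x v))
    (fun y => M (slice v (splitAt v (y, x₀ v)) ψ))
    (fun y j => by
      have := splitAt_self v y j
      rw [this, splitAt_eq v y (x₀ v) j, slice_update])
  have hy := f1.1.1 (summable_sq ψ)
  have hys := f1.2 (summable_sq ψ)
  rw [← norm_sq_eq_tsum] at hys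
  have hb : ∀ y : ∀ w : {w // w ≠ v}, ι w, ‖M (slice v (splitAt v (y, x₀ v)) ψ)‖ ^ 2
      ≤ ‖M‖ ^ 2 * ‖slice v (splitAt v (y, x₀ v)) ψ‖ ^ 2 := by
    intro y
    rw [← mul_pow]
    exact pow_le_pow_left₀ (norm_nonneg _) (M.le_opNorm _) 2
  have hMy := Summable.of_nonneg_of_le (fun _ => by positivity) hb (hy.mul_left _)
  have hM := f2.1.2 hMy
  refine ⟨hM, ?_⟩
  rw [f2.2 hM]
  refine (hMy.tsum_le_tsum hb (hy.mul_left _)).trans (le_of_eq ?_)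
  rw [tsum_mul_left, ← hys, mul_pow]

/-- The operator `M` on subsystem `v` regarded as the operator `M ⊗ 1` on the joint space. -/
def siteOp (v : V) (M : L2 (ι v) →L[ℂ] L2 (ι v)) : Joint ι →L[ℂ] Joint ι :=
  LinearMap.mkContinuous
    { toFun := fun ψ => ⟨fun x => M (slice v x ψ) (x v), memL2_iff.2 (hasSum_siteOp v M ψ).1⟩
      map_add' := fun ψ φ => by
        apply lp.ext
        funext x
        change M (slice v x (ψ + φ)) (x v) = M (slice v x ψ) (x v) + M (slice v x φ) (x v)
        rw [map_add, map_add]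
        rfl
      map_smul' := fun c ψ => by
        apply lp.ext
        funext x
        change M (slice v x (c • ψ)) (x v) = c • M (slice v x ψ) (x v)
        rw [map_smul, map_smul]
        rfl }
    ‖M‖
    (fun ψ => by
      refine le_of_sq_le_sq ?_ (by positivity)
      rw [norm_sq_eq_tsum]
      exact (hasSum_siteOp v M ψ).2)

@[simp] theorem siteOp_apply (v : V) (M : L2 (ι v) →L[ℂ] L2 (ι v)) (ψ : Joint ι)
    (x : ∀ w, ι w) : siteOp v M ψ x = M (slice v x ψ) (x v) := rfl

theorem siteOp_single [∀ w, DecidableEq (ι w)] [DecidableEq (∀ w, ι w)] (v : V)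
    (M : L2 (ι v) →L[ℂ] L2 (ι v)) (x y : ∀ w, ι w) [Decidable (∀ w, w ≠ v → y w = x w)] :
    siteOp v M (lp.single 2 x (1 : ℂ)) y =
      if ∀ w, w ≠ v → y w = x w then M (lp.single 2 (x v) (1 : ℂ)) (y v) else 0 := by
  rw [siteOp_apply]
  split_ifs with h
  · have hs : slice v y (lp.single 2 x (1 : ℂ)) = lp.single 2 (x v) (1 : ℂ) := ?_
    · rw [hs]
    apply lp.ext
    funext j
    rw [slice_apply, lp.single_apply, lp.single_apply]
    have : Function.update y v j = x ↔ j = x v := by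
      constructor
      · intro hh; rw [← hh]; simp
      · intro hh
        funext w
        by_cases hw : w = v
        · subst hw; simpa using hh
        · simp [hw, h w hw]
    by_cases hj : j = x v
    · rw [this.2 hj, hj]; simp
    · rw [Pi.single_eq_of_ne hj, Pi.single_eq_of_ne (fun hh => hj (this.1 hh))]
  · have : slice v y (lp.single 2 x (1 : ℂ)) = 0 := by
      apply lp.ext
      funext j
      rw [slice_apply, lp.single_apply, Pi.single_eq_of_ne]
      · rfl
      · intro hh
        exact h fun w hw => by rw [← hh]; simp [hw]
    rw [this, map_zero]
    rfl

theorem siteOp_siteOp_single [∀ w, DecidableEq (ι w)] [DecidableEq (∀ w, ι w)] {u v : V}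
    (huv : u ≠ v) (M : L2 (ι u) →L[ℂ] L2 (ι u)) (N : L2 (ι v) →L[ℂ] L2 (ι v))
    (x y : ∀ w, ι w) [Decidable (∀ w, w ≠ u → w ≠ v → y w = x w)] :
    siteOp u M (siteOp v N (lp.single 2 x (1 : ℂ))) y =
      if ∀ w, w ≠ u → w ≠ v → y w = x w then
        M (lp.single 2 (x u) (1 : ℂ)) (y u) * N (lp.single 2 (x v) (1 : ℂ)) (y v) else 0 := by
  classical
  rw [siteOp_apply]
  have hs : slice u y (siteOp v N (lp.single 2 x (1 : ℂ))) =
      (if ∀ w, w ≠ u → w ≠ v → y w = x w then N (lp.single 2 (x v) (1 : ℂ)) (y v) else 0) •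
        lp.single 2 (x u) (1 : ℂ) := by
    apply lp.ext
    funext j
    rw [slice_apply, siteOp_single, Function.update_of_ne huv.symm, lp.coeFn_smul, Pi.smul_apply,
      lp.single_apply]
    by_cases hj : j = x u
    · subst hj
      rw [Pi.single_eq_same, smul_eq_mul, mul_one]
      refine if_congr ⟨fun h w hu hv => ?_, fun h w hv => ?_⟩ rfl rfl
      · simpa [hu] using h w hv
      · by_cases hu : w = u
        · subst hu; simp
        · simpa [hu] using h w hu hv
    · rw [Pi.single_eq_of_ne hj, smul_zero, if_neg]
      intro h
      exact hj (by simpa using h u huv)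
  rw [hs, map_smul, lp.coeFn_smul, Pi.smul_apply, smul_eq_mul]
  split_ifs
  · rw [mul_comm]
  · rw [zero_mul]

/-- Operators on different subsystems commute. -/
theorem siteOp_commute {u v : V} (huv : u ≠ v) (M : L2 (ι u) →L[ℂ] L2 (ι u))
    (N : L2 (ι v) →L[ℂ] L2 (ι v)) : Commute (siteOp u M) (siteOp v N) := by
  classical
  refine lp.ext_continuousLinearMap (𝕜 := ℂ) (by norm_num) fun x => ?_
  ext
  rename_i y
  change siteOp u M (siteOp v N (lp.single 2 x (1 : ℂ))) y =
    siteOp v N (siteOp u M (lp.single 2 x (1 : ℂ))) y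
  rw [siteOp_siteOp_single huv, siteOp_siteOp_single huv.symm]
  refine if_congr ⟨fun h w hv hu => h w hu hv, fun h w hu hv => h w hv hu⟩ ?_ rfl
  rw [mul_comm]

end Site

section Tensor

variable {V : Type*} [Fintype V]

/-- The product vector `⨂ v, f v`. -/
def prodVec {ι : V → Type*} (f : ∀ v, L2 (ι v)) : Joint ι :=
  ⟨fun x => ∏ v, f v (x v), memL2_iff.2 (by
    classical
    refine summable_of_sum_le (c := ∏ v, ∑' j, ‖f v j‖ ^ 2) (fun _ => by positivity) fun s => ?_
    calc ∑ x ∈ s, ‖∏ v, f v (x v)‖ ^ 2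
        ≤ ∑ x ∈ Fintype.piFinset fun v => s.image fun x => x v, ‖∏ v, f v (x v)‖ ^ 2 := by
          refine Finset.sum_le_sum_of_subset_of_nonneg (fun x hx => ?_) fun _ _ _ => by positivity
          exact Fintype.mem_piFinset.2 fun v => Finset.mem_image_of_mem _ hx
      _ = ∏ v, ∑ j ∈ s.image fun x => x v, ‖f v j‖ ^ 2 := by
          rw [Finset.prod_univ_sum]
          refine Finset.sum_congr rfl fun x _ => ?_
          rw [norm_prod, Finset.prod_pow]
      _ ≤ ∏ v, ∑' j, ‖f v j‖ ^ 2 :=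
          Finset.prod_le_prod (fun _ _ => Finset.sum_nonneg fun _ _ => by positivity)
            fun v _ => (summable_sq (f v)).sum_le_tsum _ fun _ _ => by positivity)⟩

@[simp] theorem prodVec_apply {ι : V → Type*} (f : ∀ v, L2 (ι v)) (x : ∀ v, ι v) :
    prodVec f x = ∏ v, f v (x v) := rfl

/-- `Φ` is a local isometry: `Φ = ⨂ v, Φ v` for isometries `Φ v` of the single subsystems. As
product vectors span a dense subspace, `Φ` is determined by its values on them. -/
def IsLocalIsometry {ι κ : V → Type*} (Φ : Joint ι →ₗᵢ[ℂ] Joint κ) : Prop :=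
  ∃ Φloc : ∀ v, L2 (ι v) →ₗᵢ[ℂ] L2 (κ v),
    ∀ f : ∀ v, L2 (ι v), Φ (prodVec f) = prodVec fun v => Φloc v (f v)

theorem tensor_mem {V : Type*} {J K : V → Type*} (a : Joint J) (b : Joint K) :
    Memℓp (fun x : ∀ v, J v × K v => a (fun v => (x v).1) * b (fun v => (x v).2)) 2 := by
  rw [memL2_iff]
  have h := (summable_sq a).mul_of_nonneg (summable_sq b) (fun _ => by positivity)
    (fun _ => by positivity)
  let e : (∀ v, J v × K v) ≃ (∀ v, J v) × (∀ v, K v) :=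
    ⟨fun x => (fun v => (x v).1, fun v => (x v).2), fun y v => (y.1 v, y.2 v),
      fun _ => rfl, fun _ => rfl⟩
  refine (e.summable_iff.2 h).congr fun x => ?_
  rw [norm_mul, mul_pow]
  rfl

/-- The tensor product `a ⊗ b` of two joint vectors, where subsystem `v` of the result consists
of subsystem `v` of `a` together with subsystem `v` of `b`. -/
def tensor {V : Type*} {J K : V → Type*} (a : Joint J) (b : Joint K) : Joint fun v => J v × K v :=
  ⟨fun x => a (fun v => (x v).1) * b (fun v => (x v).2), tensor_mem a b⟩

variable [DecidableEq V]

/-- `M ^ x = ⨂ v, M v ^ (x v)` for a bit string `x`. -/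
def opPow {ι : V → Type*} (M : ∀ v, L2 (ι v) →L[ℂ] L2 (ι v)) (x : V → ZMod 2) :
    Joint ι →L[ℂ] Joint ι :=
  Finset.univ.noncommProd (fun v => siteOp v (M v ^ (x v).val))
    fun _ _ _ _ huv => siteOp_commute huv _ _

/-- Observables with eigenvalues in `{1, -1}`. -/
def IsPMObservable {α : Type*} (M : L2 α →L[ℂ] L2 α) : Prop :=
  IsSelfAdjoint M ∧ M * M = 1

/-- The expectation value `⟨ψ| T |ψ⟩`; it is real for the self-adjoint `T` it is used for. -/
def expect {α : Type*} (ψ : L2 α) (T : L2 α →L[ℂ] L2 α) : ℝ := (inner ℂ ψ (T ψ)).re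

end Tensor

section Qubits

/-- The operator on the qubit space `ℓ²({0, 1})` with the given matrix. -/
def qubitOp (A : Matrix (ZMod 2) (ZMod 2) ℂ) : L2 (ZMod 2) →L[ℂ] L2 (ZMod 2) :=
  ((lpPiLpₗᵢ (fun _ : ZMod 2 => ℂ) ℂ).symm.toContinuousLinearEquiv.toContinuousLinearMap).comp
    ((Matrix.toEuclideanCLM (𝕜 := ℂ) A).comp
      (lpPiLpₗᵢ (fun _ : ZMod 2 => ℂ) ℂ).toContinuousLinearEquiv.toContinuousLinearMap)

def pauliX : L2 (ZMod 2) →L[ℂ] L2 (ZMod 2) :=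
  qubitOp (Matrix.of fun a b => if a = b then 0 else 1)

def pauliZ : L2 (ZMod 2) →L[ℂ] L2 (ZMod 2) :=
  qubitOp (Matrix.diagonal fun a => if a = 0 then 1 else -1)

/-- `R(θ) = cos θ X + sin θ Z`. -/
def xzPlane (θ : ℝ) : L2 (ZMod 2) →L[ℂ] L2 (ZMod 2) :=
  (Real.cos θ : ℂ) • pauliX + (Real.sin θ : ℂ) • pauliZ

variable {V : Type*} [Fintype V] [DecidableEq V] (G : SimpleGraph V) [DecidableRel G.Adj]

/-- The bit string `1_v`. -/
def bit (v : V) : V → ZMod 2 := Pi.single v 1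

/-- The characteristic bit string of a set of vertices. -/
def indicatorBits (T : Finset V) : V → ZMod 2 := fun v => if v ∈ T then 1 else 0

/-- The bit string `A x`, with `A` the adjacency matrix. -/
def nbrBits (x : V → ZMod 2) : V → ZMod 2 := G.adjMatrix (ZMod 2) *ᵥ x

/-- `s ⬝ t` evaluated over the integers. -/
def bitDot (s t : V → ZMod 2) : ℕ := ∑ v, (s v).val * (t v).val

/-- `x ⬝ A x` evaluated over the integers: twice the number of edges inside the support of `x`. -/
def quadForm (x : V → ZMod 2) : ℕ :=
  ∑ u, ∑ v, (x u).val * G.adjMatrix ℕ u v * (x v).val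

/-- The graph state `2 ^ (-n / 2) ∑ x, (-1) ^ (x ⬝ A x / 2) |x⟩`. -/
def graphState : Joint fun _ : V => ZMod 2 :=
  ⟨fun x => (-1) ^ (quadForm G x / 2) / (Real.sqrt (2 ^ Fintype.card V) : ℂ), Memℓp.all _⟩

/-- `δ(p) = (2 √(p ⬝ p) + 2 √(2 n) + √(|E| + n)) (2 ε) ^ (1 / 4)`. -/
def delta (ε : ℝ) (p : V → ZMod 2) : ℝ :=
  (2 * Real.sqrt (bitDot p p) + 2 * Real.sqrt (2 * Fintype.card V) +
    Real.sqrt (G.edgeFinset.card + Fintype.card V)) * (2 * ε) ^ (1 / 4 : ℝ)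

end Qubits

end GraphSelfTest

end

open GraphSelfTest

/-!
The state is carried to the graph state by the *swap isometry*, whose factor at a vertex `v` is
`f ↦ ½ ((1 + X_v) f ⊗ |+⟩ + Z_v (1 - X_v) f ⊗ |-⟩)`. It intertwines `X_v` with the qubit operator
`X` exactly, and it pulls the qubit operator `Z` back to `Y_v = ½ (Z_v - X_v Z_v X_v)`. All matrix
elements needed below are therefore expectations on the original state of products of the `X_v`
and `Y_v` (`opProd_swapKraus_opPow`, `sum_inner_swapKraus`). Write `η = √(2 ε)`.

*Anticommutation.* In the product of the triangle operator with the three vertex operators of a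
triangle, everything cancels except `X_v Z_v X_v Z_v` at one vertex (`triangle_mul_vertices`). The
triangle operator acts on `ψ` as `-1` and the vertex operators as `1`, each up to `η`, so that
`‖(X_v Z_v + Z_v X_v) ψ‖ ≤ 4 η` at every vertex (`norm_anticommutator_le`). Consequently `Y ^ p` and
`Z ^ p` differ on `ψ` by at most `2 |p| η` (`norm_opPow_swapZ_sub_le`), and passing `Z ^ p` through
the isometry, an operation between unit vectors, costs at most `√(4 |p| η)`
(`norm_swapIsometry_opPow_sub_le`).

*Extraction of the graph state.* The projection onto the graph state is the average over all bit
strings `x` of its stabilizers `± X ^ x Z ^ (A x)`. Pulled back to `ψ`, each of them has expectation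
at least `1 - 7 n η`: switching on one bit of `x` uses one vertex operator and at most one
anticommutation, which gives `5 n η` (`norm_opPow_sub_graphSign_smul_le`), and replacing `Y` by `Z`
gives `2 n η`. So the partial inner product of the image of `ψ` with the graph state has squared
norm at least `1 - 7 n η` (`norm_junkVector_sq_ge`), and its normalization serves as the junk
vector, with error at most `√(14 n η) ≤ (2 √2 + 1) √n (2 ε) ^ (1 / 4)` (`exists_junk`).

*The `XZ` plane.* On the graph state, `R_v(θ)` agrees with the combination
`cos θ Z ^ (A 1_v) + sin θ X_u Z ^ (A 1_u + 1_v)` (`siteOp_xzPlane_graphState`), which the isometry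
respects up to `(|cos θ| + |sin θ|) δ ≤ 2 δ`. The assumed correlation of the observable with that
combination then bounds the distance of the two unit vectors (`norm_sub_xzPlane_le`).
-/

namespace GraphSelfTest

open ContinuousLinearMap

/-! ### Product operators -/

section Product

variable {V : Type*} [DecidableEq V] {ι : V → Type*}

theorem slice_siteOp (v : V) (M : L2 (ι v) →L[ℂ] L2 (ι v)) (x : ∀ w, ι w) (ψ : Joint ι) :
    slice v x (siteOp v M ψ) = M (slice v x ψ) := by
  apply lp.ext
  funext j
  rw [slice_apply, siteOp_apply, slice_update, Function.update_self]

theorem siteOp_one (v : V) : siteOp v (1 : L2 (ι v) →L[ℂ] L2 (ι v)) = 1 := by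
  ext ψ x
  change slice v x ψ (x v) = ψ x
  simp

theorem siteOp_mul (v : V) (M N : L2 (ι v) →L[ℂ] L2 (ι v)) :
    siteOp v (M * N) = siteOp v M * siteOp v N := by
  ext ψ x
  change M (N (slice v x ψ)) (x v) = M (slice v x (siteOp v N ψ)) (x v)
  rw [slice_siteOp]

theorem siteOp_add (v : V) (M N : L2 (ι v) →L[ℂ] L2 (ι v)) :
    siteOp v (M + N) = siteOp v M + siteOp v N := by
  ext ψ x
  rfl

theorem siteOp_smul (v : V) (c : ℂ) (M : L2 (ι v) →L[ℂ] L2 (ι v)) :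
    siteOp v (c • M) = c • siteOp v M := by
  ext ψ x
  rfl

theorem siteOp_sub (v : V) (M N : L2 (ι v) →L[ℂ] L2 (ι v)) :
    siteOp v (M - N) = siteOp v M - siteOp v N := by
  ext ψ x
  rfl

theorem single_ext_apply {α : Type*} [DecidableEq α] (f : L2 α) (y : α) :
    f y = inner ℂ (lp.single 2 y (1 : ℂ) : L2 α) f := by
  rw [lp.inner_single_left]
  simp

theorem siteOp_adjoint (v : V) (M : L2 (ι v) →L[ℂ] L2 (ι v)) :
    siteOp v (adjoint M) = adjoint (siteOp v M) := by
  classical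
  refine lp.ext_continuousLinearMap (𝕜 := ℂ) (by norm_num) fun x => ?_
  ext
  rename_i y
  change siteOp v (adjoint M) (lp.single 2 x (1 : ℂ)) y =
    adjoint (siteOp v M) (lp.single 2 x (1 : ℂ)) y
  rw [single_ext_apply (adjoint (siteOp v M) _) y, adjoint_inner_right, ← inner_conj_symm,
    ← single_ext_apply, siteOp_single, siteOp_single]
  by_cases h : ∀ w, w ≠ v → y w = x w
  · rw [if_pos h, if_pos fun w hw => (h w hw).symm, single_ext_apply (adjoint M _) (y v),
      adjoint_inner_right, ← inner_conj_symm, ← single_ext_apply]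
  · rw [if_neg h, if_neg fun h' => h fun w hw => (h' w hw).symm, map_zero]

variable [Fintype V]

theorem siteOp_prodVec (v : V) (M : L2 (ι v) →L[ℂ] L2 (ι v)) (f : ∀ w, L2 (ι w)) :
    siteOp v M (prodVec f) = prodVec (Function.update f v (M (f v))) := by
  apply lp.ext
  funext x
  have hs : slice v x (prodVec f) = (∏ w ∈ Finset.univ.erase v, f w (x w)) • f v := by
    apply lp.ext
    funext j
    rw [slice_apply, prodVec_apply, lp.coeFn_smul, Pi.smul_apply, smul_eq_mul,
      ← Finset.prod_erase_mul _ _ (Finset.mem_univ v), Function.update_self]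
    congr 1
    exact Finset.prod_congr rfl fun w hw => by
      rw [Function.update_of_ne (Finset.ne_of_mem_erase hw)]
  rw [siteOp_apply, hs, map_smul, lp.coeFn_smul, Pi.smul_apply, smul_eq_mul, prodVec_apply,
    ← Finset.prod_erase_mul _ _ (Finset.mem_univ v), Function.update_self]
  congr 1
  exact Finset.prod_congr rfl fun w hw => by rw [Function.update_of_ne (Finset.ne_of_mem_erase hw)]

/-- `siteOp v` as a monoid homomorphism. -/
noncomputable def siteHom (v : V) : (L2 (ι v) →L[ℂ] L2 (ι v)) →* (Joint ι →L[ℂ] Joint ι) where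
  toFun := siteOp v
  map_one' := siteOp_one v
  map_mul' := siteOp_mul v

/-- The product operator `⨂ v, M v`, as a monoid homomorphism in the family `M`. -/
noncomputable def opProd :
    (∀ v, L2 (ι v) →L[ℂ] L2 (ι v)) →* (Joint ι →L[ℂ] Joint ι) :=
  MonoidHom.noncommPiCoprod siteHom fun _ _ h M N => siteOp_commute h M N

theorem opProd_mulSingle (v : V) (M : L2 (ι v) →L[ℂ] L2 (ι v)) :
    opProd (Pi.mulSingle v M) = siteOp v M :=
  MonoidHom.noncommPiCoprod_mulSingle (N := fun v => L2 (ι v) →L[ℂ] L2 (ι v)) siteHom v M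

theorem opPow_eq_opProd (M : ∀ v, L2 (ι v) →L[ℂ] L2 (ι v)) (x : V → ZMod 2) :
    opPow M x = opProd fun v => M v ^ (x v).val := rfl

theorem opProd_eq_siteOp_mul (M : ∀ v, L2 (ι v) →L[ℂ] L2 (ι v)) (v : V) :
    opProd M = siteOp v (M v) * opProd (Function.update M v 1) := by
  rw [← opProd_mulSingle, ← map_mul]
  congr 1
  funext w
  by_cases h : w = v
  · subst h; simp
  · simp [h]

/-- The product operator as a multilinear function of its factors. -/
noncomputable def opProdMultilinear :
    MultilinearMap ℂ (fun v => L2 (ι v) →L[ℂ] L2 (ι v)) (Joint ι →L[ℂ] Joint ι) :=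
  MultilinearMap.mk' opProd
    (fun M v A B => by
      rw [opProd_eq_siteOp_mul _ v, opProd_eq_siteOp_mul (Function.update M v A) v,
        opProd_eq_siteOp_mul (Function.update M v B) v]
      simp only [Function.update_self, Function.update_idem, siteOp_add, add_mul])
    (fun M v c A => by
      rw [opProd_eq_siteOp_mul _ v, opProd_eq_siteOp_mul (Function.update M v A) v]
      simp only [Function.update_self, Function.update_idem, siteOp_smul, smul_mul_assoc])

theorem opProd_sum {β : Type*} [Fintype β] [DecidableEq β]
    (M : ∀ v, β → (L2 (ι v) →L[ℂ] L2 (ι v))) :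
    opProd (fun v => ∑ b, M v b) = ∑ r : V → β, opProd fun v => M v (r v) :=
  (opProdMultilinear (ι := ι)).map_sum M

theorem opProd_smul (c : V → ℂ) (M : ∀ v, L2 (ι v) →L[ℂ] L2 (ι v)) :
    opProd (fun v => c v • M v) = (∏ v, c v) • opProd M :=
  (opProdMultilinear (ι := ι)).map_smul_univ c M

/-- Families indexed by a finite type are generated by the families supported at one index. -/
theorem pi_induction_mulSingle {N : V → Type*} [∀ v, Monoid (N v)] {P : (∀ v, N v) → Prop}
    (one : P 1) (step : ∀ v (a : N v) M, P M → P (Pi.mulSingle v a * M)) (M : ∀ v, N v) : P M := by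
  suffices h : ∀ s : Finset V, P fun v => if v ∈ s then M v else 1 by simpa using h Finset.univ
  intro s
  induction s using Finset.induction_on with
  | empty =>
    convert one using 1
    funext w
    simp
  | insert v s hv ih =>
    convert step v (M v) _ ih using 1
    funext w
    by_cases h : w = v
    · subst h; simp [hv]
    · simp [h]

theorem opProd_prodVec (M : ∀ v, L2 (ι v) →L[ℂ] L2 (ι v)) (f : ∀ v, L2 (ι v)) :
    opProd M (prodVec f) = prodVec fun v => M v (f v) := by
  induction M using pi_induction_mulSingle with
  | one => rw [map_one]; rfl
  | step v A M ih =>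
    rw [map_mul, mul_apply_eq_comp, ih, opProd_mulSingle, siteOp_prodVec]
    congr 1
    funext w
    by_cases h : w = v
    · subst h; simp
    · simp [h]

theorem opProd_adjoint (M : ∀ v, L2 (ι v) →L[ℂ] L2 (ι v)) :
    opProd (fun v => adjoint (M v)) = adjoint (opProd M) := by
  simp only [← ContinuousLinearMap.star_eq_adjoint]
  change opProd (star M) = star (opProd M)
  induction M using pi_induction_mulSingle with
  | one => simp
  | step v A M ih =>
    have h : star (Pi.mulSingle v A : ∀ w, L2 (ι w) →L[ℂ] L2 (ι w)) = Pi.mulSingle v (star A) := by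
      funext w
      by_cases h : w = v
      · subst h; simp
      · simp [h]
    rw [star_mul, map_mul, map_mul, star_mul, ih, h, opProd_mulSingle, opProd_mulSingle,
      ContinuousLinearMap.star_eq_adjoint A, siteOp_adjoint,
      ContinuousLinearMap.star_eq_adjoint (siteOp v A)]

end Product

/-! ### Bit strings and powers of operators -/

section Bits

variable {V : Type*}

theorem zmod_two_cases (a : ZMod 2) : a = 0 ∨ a = 1 := by
  revert a; decide

theorem val_one_zmod_two : (1 : ZMod 2).val = 1 := rfl

theorem bits_add_self (x : V → ZMod 2) : x + x = 0 := by
  funext v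
  exact CharTwo.add_self_eq_zero _

variable [Fintype V]

theorem bitDot_self_le (x : V → ZMod 2) : bitDot x x ≤ Fintype.card V := by
  calc bitDot x x ≤ ∑ _v : V, 1 := Finset.sum_le_sum fun v _ => by
        rcases zmod_two_cases (x v) with h | h <;> simp [h, val_one_zmod_two]
    _ = _ := by simp

variable [DecidableEq V]

/-- Induction on bit strings, switching on one bit at a time. -/
theorem bits_induction {P : (V → ZMod 2) → Prop} (zero : P 0)
    (step : ∀ v x, x v = 0 → P x → P (x + bit v)) (x : V → ZMod 2) : P x := by
  suffices h : ∀ s : Finset V, P fun v => if v ∈ s then x v else 0 by simpa using h Finset.univ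
  intro s
  induction s using Finset.induction_on with
  | empty =>
    convert zero using 1
    funext w
    simp
  | insert v s hv ih =>
    rcases zmod_two_cases (x v) with h0 | h1
    · convert ih using 1
      funext w
      by_cases h : w = v
      · subst h; simp [hv, h0]
      · simp [h]
    · convert step v _ (by simp [hv]) ih using 1
      funext w
      by_cases h : w = v
      · subst h; simp [hv, h1, bit]
      · simp [h, bit]

theorem bitDot_self_add_bit {v : V} {x : V → ZMod 2} (hx : x v = 0) :
    bitDot (x + bit v) (x + bit v) = bitDot x x + 1 := by
  unfold bitDot
  rw [← Finset.sum_erase_add _ _ (Finset.mem_univ v),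
    ← Finset.sum_erase_add Finset.univ (fun w => (x w).val * (x w).val) (Finset.mem_univ v)]
  simp only [Pi.add_apply, hx, bit, Pi.single_eq_same, zero_add, val_one_zmod_two, mul_one,
    ZMod.val_zero, mul_zero, add_zero, add_left_inj]
  refine Finset.sum_congr rfl fun w hw => ?_
  rw [Pi.single_eq_of_ne (Finset.ne_of_mem_erase hw), add_zero]

variable {ι : V → Type*} (M : ∀ v, L2 (ι v) →L[ℂ] L2 (ι v))

theorem opPow_zero : opPow M 0 = 1 := by
  rw [opPow_eq_opProd, ← map_one opProd]
  congr 1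

theorem opPow_bit (v : V) : opPow M (bit v) = siteOp v (M v) := by
  rw [opPow_eq_opProd, ← opProd_mulSingle]
  congr 1
  funext w
  by_cases h : w = v
  · subst h; simp [bit, val_one_zmod_two]
  · simp [h, bit]

variable {M}

theorem opPow_bit_add {v : V} {x : V → ZMod 2} (hx : x v = 0) :
    opPow M (x + bit v) = siteOp v (M v) * opPow M x := by
  rw [← opPow_bit, opPow_eq_opProd, opPow_eq_opProd, opPow_eq_opProd, ← map_mul]
  congr 1
  funext w
  by_cases h : w = v
  · subst h; simp [bit, hx]
  · simp [h, bit]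

theorem opPow_add (hM : ∀ v, M v * M v = 1) (x y : V → ZMod 2) :
    opPow M (x + y) = opPow M x * opPow M y := by
  rw [opPow_eq_opProd, opPow_eq_opProd, opPow_eq_opProd, ← map_mul]
  congr 1
  funext v
  change _ = M v ^ (x v).val * M v ^ (y v).val
  rcases zmod_two_cases (x v) with h | h <;> rcases zmod_two_cases (y v) with h' | h' <;>
    simp [h, h', val_one_zmod_two, CharTwo.add_self_eq_zero, hM]

theorem opPow_mul_self (hM : ∀ v, M v * M v = 1) (x : V → ZMod 2) :
    opPow M x * opPow M x = 1 := by
  rw [← opPow_add hM, bits_add_self, opPow_zero]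

theorem siteOp_commute_opPow {v : V} {x : V → ZMod 2} (hx : x v = 0)
    (A : L2 (ι v) →L[ℂ] L2 (ι v)) : Commute (siteOp v A) (opPow M x) := by
  rw [← opProd_mulSingle, opPow_eq_opProd]
  refine Commute.map ?_ opProd
  funext w
  by_cases h : w = v
  · subst h; simp [hx]
  · simp [h]

theorem opPow_isSelfAdjoint (hM : ∀ v, IsSelfAdjoint (M v)) (x : V → ZMod 2) :
    IsSelfAdjoint (opPow M x) := by
  rw [isSelfAdjoint_iff, ContinuousLinearMap.star_eq_adjoint, opPow_eq_opProd, ← opProd_adjoint]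
  congr 1
  funext v
  exact ((hM v).pow _).adjoint_eq

end Bits

/-! ### Observables with values `±1` -/

section Observable

variable {α : Type*} {M : L2 α →L[ℂ] L2 α}

theorem IsPMObservable.inner_left (hM : IsPMObservable M) (f g : L2 α) :
    inner ℂ (M f) g = inner ℂ f (M g) := by
  rw [← ContinuousLinearMap.adjoint_inner_right, hM.1.adjoint_eq]

theorem IsPMObservable.apply_apply (hM : IsPMObservable M) (f : L2 α) : M (M f) = f := by
  rw [← mul_apply_eq_comp, hM.2]; rfl

theorem IsPMObservable.norm_apply (hM : IsPMObservable M) (f : L2 α) : ‖M f‖ = ‖f‖ := by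
  have h : inner ℂ (M f) (M f) = inner ℂ f f := by rw [hM.inner_left, hM.apply_apply]
  rw [inner_self_eq_norm_sq_to_K, inner_self_eq_norm_sq_to_K] at h
  have h' : ‖M f‖ ^ 2 = ‖f‖ ^ 2 := by exact_mod_cast h
  exact (sq_eq_sq₀ (norm_nonneg _) (norm_nonneg _)).1 h'

variable {V : Type*} [DecidableEq V] {ι : V → Type*}

theorem IsPMObservable.siteOp {v : V} {M : L2 (ι v) →L[ℂ] L2 (ι v)} (hM : IsPMObservable M) :
    IsPMObservable (siteOp v M) := by
  refine ⟨?_, by rw [← siteOp_mul, hM.2, siteOp_one]⟩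
  rw [isSelfAdjoint_iff, ContinuousLinearMap.star_eq_adjoint, ← siteOp_adjoint, hM.1.adjoint_eq]

theorem IsPMObservable.opPow [Fintype V] {M : ∀ v, L2 (ι v) →L[ℂ] L2 (ι v)}
    (hM : ∀ v, IsPMObservable (M v)) (x : V → ZMod 2) : IsPMObservable (opPow M x) :=
  ⟨opPow_isSelfAdjoint (fun v => (hM v).1) x, opPow_mul_self (fun v => (hM v).2) x⟩

end Observable

/-! ### Signs and the quadratic form of a graph -/

section Sign

/-- The character `a ↦ (-1) ^ a` of `ZMod 2`. -/
noncomputable def zsign (a : ZMod 2) : ℂ := (-1) ^ a.val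

@[simp] theorem zsign_zero : zsign 0 = 1 := by simp [zsign]

@[simp] theorem zsign_one : zsign 1 = -1 := by simp [zsign, val_one_zmod_two]

theorem zsign_add (a b : ZMod 2) : zsign (a + b) = zsign a * zsign b := by
  rcases zmod_two_cases a with rfl | rfl <;> rcases zmod_two_cases b with rfl | rfl <;>
    simp [CharTwo.add_self_eq_zero]

theorem zsign_mul_self (a : ZMod 2) : zsign a * zsign a = 1 := by
  rw [← zsign_add, CharTwo.add_self_eq_zero, zsign_zero]

@[simp] theorem norm_zsign (a : ZMod 2) : ‖zsign a‖ = 1 := by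
  rcases zmod_two_cases a with rfl | rfl <;> simp

@[simp] theorem conj_zsign (a : ZMod 2) : (starRingEnd ℂ) (zsign a) = zsign a := by
  rcases zmod_two_cases a with rfl | rfl <;> simp

theorem zsign_natCast (m : ℕ) : zsign (m : ZMod 2) = (-1) ^ m := by
  induction m with
  | zero => simp
  | succ m ih => rw [Nat.cast_succ, zsign_add, ih, zsign_one, pow_succ]

theorem zsign_sum {κ : Type*} (s : Finset κ) (f : κ → ZMod 2) :
    zsign (∑ i ∈ s, f i) = ∏ i ∈ s, zsign (f i) := by
  classical
  induction s using Finset.induction_on with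
  | empty => simp
  | insert i s hi ih => rw [Finset.sum_insert hi, Finset.prod_insert hi, zsign_add, ih]

theorem sum_zmod_two {A : Type*} [AddCommMonoid A] (f : ZMod 2 → A) : ∑ b, f b = f 0 + f 1 :=
  Fin.sum_univ_two f

variable {V : Type*} [Fintype V]

/-- A double sum without diagonal terms, as a sum over the pairs that are increasing for an
auxiliary enumeration of the index type. -/
theorem sum_sum_eq_sum_lt {A : Type*} [AddCommMonoid A] (f : V → V → A) (hf : ∀ v, f v v = 0) :
    ∑ u, ∑ v, f u v =
      ∑ u, ∑ v, if Fintype.equivFin V u < Fintype.equivFin V v then f u v + f v u else 0 := by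
  have h : ∀ u v, f u v = (if Fintype.equivFin V u < Fintype.equivFin V v then f u v else 0) +
      if Fintype.equivFin V v < Fintype.equivFin V u then f u v else 0 := by
    intro u v
    rcases lt_trichotomy (Fintype.equivFin V u) (Fintype.equivFin V v) with h | h | h
    · simp [h, h.not_gt]
    · rw [(Fintype.equivFin V).injective h, hf]; simp
    · simp [h, h.not_gt]
  rw [Finset.sum_congr rfl fun u _ => Finset.sum_congr rfl fun v _ => h u v]
  simp only [Finset.sum_add_distrib]
  nth_rw 2 [Finset.sum_comm]
  simp only [← Finset.sum_add_distrib]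
  refine Finset.sum_congr rfl fun u _ => Finset.sum_congr rfl fun v _ => ?_
  split_ifs <;> simp

variable (G : SimpleGraph V) [DecidableRel G.Adj]

/-- The sign `(-1) ^ (x ⬝ A x / 2)`. -/
noncomputable def graphSign (x : V → ZMod 2) : ℂ := (-1) ^ (quadForm G x / 2)

theorem graphState_apply (x : V → ZMod 2) :
    graphState G x = graphSign G x / (Real.sqrt (2 ^ Fintype.card V) : ℂ) := rfl

theorem graphSign_eq (x : V → ZMod 2) :
    graphSign G x = zsign (∑ u, ∑ v, if Fintype.equivFin V u < Fintype.equivFin V v then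
      x u * G.adjMatrix (ZMod 2) u v * x v else 0) := by
  have h : quadForm G x = 2 * ∑ u, ∑ v, if Fintype.equivFin V u < Fintype.equivFin V v then
      (x u).val * G.adjMatrix ℕ u v * (x v).val else 0 := by
    unfold quadForm
    rw [sum_sum_eq_sum_lt _ (by simp), Finset.mul_sum]
    refine Finset.sum_congr rfl fun u _ => ?_
    rw [Finset.mul_sum]
    refine Finset.sum_congr rfl fun v _ => ?_
    split_ifs
    · simp only [SimpleGraph.adjMatrix_apply, G.adj_comm v u]
      ring
    · rfl
  rw [graphSign, h, Nat.mul_div_cancel_left _ (by norm_num), ← zsign_natCast]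
  congr 1
  push_cast
  refine Finset.sum_congr rfl fun u _ => Finset.sum_congr rfl fun v _ => ?_
  simp [SimpleGraph.adjMatrix_apply]

/-- The quadratic form `x ⬝ A x / 2` modulo `2` has polar form `x ⬝ A y`. -/
theorem graphSign_add (x y : V → ZMod 2) :
    graphSign G (x + y) = graphSign G x * graphSign G y * zsign (x ⬝ᵥ nbrBits G y) := by
  have h : x ⬝ᵥ nbrBits G y = ∑ u, ∑ v, x u * G.adjMatrix (ZMod 2) u v * y v := by
    simp only [dotProduct, nbrBits, Matrix.mulVec, Finset.mul_sum, mul_assoc]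
  rw [sum_sum_eq_sum_lt (fun u v => x u * G.adjMatrix (ZMod 2) u v * y v) (by simp)] at h
  rw [graphSign_eq, graphSign_eq, graphSign_eq, ← zsign_add, ← zsign_add, h]
  congr 1
  simp only [← Finset.sum_add_distrib]
  refine Finset.sum_congr rfl fun u _ => Finset.sum_congr rfl fun v _ => ?_
  split_ifs
  · simp only [SimpleGraph.adjMatrix_apply, G.adj_comm v u, Pi.add_apply]
    ring
  · simp

theorem graphSign_zero : graphSign G 0 = 1 := by
  simp [graphSign, quadForm]

theorem graphSign_bit [DecidableEq V] (v : V) : graphSign G (bit v) = 1 := by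
  have h : quadForm G (bit v) = 0 := by
    refine Finset.sum_eq_zero fun a _ => Finset.sum_eq_zero fun b _ => ?_
    by_cases ha : a = v
    · by_cases hb : b = v
      · simp [ha, hb]
      · simp [bit, hb]
    · simp [bit, ha]
  simp [graphSign, h]

theorem graphSign_mul_self (x : V → ZMod 2) : graphSign G x * graphSign G x = 1 := by
  rw [graphSign_eq, zsign_mul_self]

@[simp] theorem norm_graphSign (x : V → ZMod 2) : ‖graphSign G x‖ = 1 := by
  rw [graphSign_eq, norm_zsign]

@[simp] theorem conj_graphSign (x : V → ZMod 2) :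
    (starRingEnd ℂ) (graphSign G x) = graphSign G x := by
  rw [graphSign_eq, conj_zsign]

theorem bit_dotProduct [DecidableEq V] (v : V) (x : V → ZMod 2) : bit v ⬝ᵥ x = x v := by
  simp [bit]

theorem nbrBits_add (x y : V → ZMod 2) : nbrBits G (x + y) = nbrBits G x + nbrBits G y :=
  Matrix.mulVec_add _ _ _

theorem nbrBits_bit_apply [DecidableEq V] (u v : V) :
    nbrBits G (bit v) u = if G.Adj u v then 1 else 0 := by
  simp [nbrBits, bit]

end Sign

/-! ### Pauli operators and graph states -/

section Pauli

theorem qubitOp_apply (A : Matrix (ZMod 2) (ZMod 2) ℂ) (f : L2 (ZMod 2)) (a : ZMod 2) :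
    qubitOp A f a = ∑ b, A a b * f b := rfl

theorem pauliX_apply (f : L2 (ZMod 2)) (a : ZMod 2) : pauliX f a = f (a + 1) := by
  rw [pauliX, qubitOp_apply, sum_zmod_two]
  rcases zmod_two_cases a with rfl | rfl <;> simp [CharTwo.add_self_eq_zero]

theorem pauliZ_apply (f : L2 (ZMod 2)) (a : ZMod 2) : pauliZ f a = zsign a * f a := by
  rw [pauliZ, qubitOp_apply, sum_zmod_two]
  rcases zmod_two_cases a with rfl | rfl <;> simp [Matrix.diagonal]

theorem inner_qubit (f g : L2 (ZMod 2)) :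
    inner ℂ f g = inner ℂ (f 0) (g 0) + inner ℂ (f 1) (g 1) := by
  rw [lp.inner_eq_tsum, tsum_fintype, sum_zmod_two]

theorem pauliX_isPMObservable : IsPMObservable pauliX := by
  constructor
  · rw [ContinuousLinearMap.isSelfAdjoint_iff_isSymmetric]
    intro f g
    change inner ℂ (pauliX f) g = inner ℂ f (pauliX g)
    rw [inner_qubit, inner_qubit]
    simp only [pauliX_apply, CharTwo.add_self_eq_zero, zero_add]
    rw [add_comm]
  · ext f a
    change pauliX (pauliX f) a = f a
    rw [pauliX_apply, pauliX_apply, add_assoc, CharTwo.add_self_eq_zero, add_zero]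

theorem pauliZ_isPMObservable : IsPMObservable pauliZ := by
  constructor
  · rw [ContinuousLinearMap.isSelfAdjoint_iff_isSymmetric]
    intro f g
    change inner ℂ (pauliZ f) g = inner ℂ f (pauliZ g)
    rw [inner_qubit, inner_qubit]
    simp [pauliZ_apply]
  · ext f a
    change pauliZ (pauliZ f) a = f a
    rw [pauliZ_apply, pauliZ_apply, ← mul_assoc, zsign_mul_self, one_mul]

theorem xzPlane_isPMObservable (θ : ℝ) : IsPMObservable (xzPlane θ) := by
  constructor
  · refine IsSelfAdjoint.add ?_ ?_
    · exact IsSelfAdjoint.smul (Complex.conj_ofReal _)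
        pauliX_isPMObservable.1
    · exact IsSelfAdjoint.smul (Complex.conj_ofReal _)
        pauliZ_isPMObservable.1
  · ext f a
    have h : (Real.cos θ : ℂ) * Real.cos θ + Real.sin θ * Real.sin θ = 1 := by
      exact_mod_cast (by nlinarith [Real.sin_sq_add_cos_sq θ] :
        Real.cos θ * Real.cos θ + Real.sin θ * Real.sin θ = 1)
    have hR : ∀ g : L2 (ZMod 2), ∀ b,
        xzPlane θ g b = Real.cos θ * g (b + 1) + Real.sin θ * (zsign b * g b) := by
      intro g b
      rw [← pauliX_apply, ← pauliZ_apply]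
      rfl
    change xzPlane θ (xzPlane θ f) a = f a
    rw [hR, hR, hR, add_assoc, CharTwo.add_self_eq_zero, add_zero, zsign_add, zsign_one]
    linear_combination (f a) * h + Real.sin θ * Real.sin θ * f a * zsign_mul_self a

variable {V : Type*} [DecidableEq V]

theorem siteOp_pauliX_apply (v : V) (g : Joint fun _ : V => ZMod 2) (b : V → ZMod 2) :
    siteOp v pauliX g b = g (b + bit v) := by
  have h : Function.update b v (b v + 1) = b + bit v := ?_
  · rw [siteOp_apply, pauliX_apply, slice_apply, h]
  funext w
  by_cases h : w = v
  · subst h; simp [bit]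
  · simp [h, bit]

theorem siteOp_pauliZ_apply (v : V) (g : Joint fun _ : V => ZMod 2) (b : V → ZMod 2) :
    siteOp v pauliZ g b = zsign (b v) * g b := by
  rw [siteOp_apply, pauliZ_apply, slice_apply, Function.update_eq_self]

variable [Fintype V]

theorem opPow_pauliX_apply (q : V → ZMod 2) (g : Joint fun _ : V => ZMod 2) (b : V → ZMod 2) :
    opPow (fun _ => pauliX) q g b = g (b + q) := by
  induction q using bits_induction generalizing b with
  | zero => rw [opPow_zero, add_zero]; rfl
  | step v q hq ih =>
    rw [opPow_bit_add hq, mul_apply_eq_comp, siteOp_pauliX_apply, ih, add_assoc, add_comm q]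

theorem opPow_pauliZ_apply (p : V → ZMod 2) (g : Joint fun _ : V => ZMod 2) (b : V → ZMod 2) :
    opPow (fun _ => pauliZ) p g b = zsign (p ⬝ᵥ b) * g b := by
  induction p using bits_induction with
  | zero => rw [opPow_zero, zero_dotProduct, zsign_zero, one_mul]; rfl
  | step v p hp ih =>
    rw [opPow_bit_add hp, mul_apply_eq_comp, siteOp_pauliZ_apply, ih, add_dotProduct, zsign_add,
      bit_dotProduct]
    ring

variable (G : SimpleGraph V) [DecidableRel G.Adj]

theorem norm_graphState : ‖graphState G‖ = 1 := by
  have h : ‖graphState G‖ ^ 2 = 1 := by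
    rw [norm_sq_eq_tsum, tsum_fintype]
    simp only [graphState_apply, norm_div, norm_graphSign, Complex.norm_real, div_pow, one_pow,
      Real.norm_eq_abs, sq_abs]
    rw [Real.sq_sqrt (by positivity)]
    simp
  exact (pow_eq_one_iff_of_nonneg (norm_nonneg _) two_ne_zero).1 h

/-- The vertex operators `X_v Z^(A 1_v)` stabilize the graph state. -/
theorem siteOp_pauliX_graphState (v : V) :
    siteOp v pauliX (graphState G) =
      opPow (fun _ => pauliZ) (nbrBits G (bit v)) (graphState G) := by
  apply lp.ext
  funext b
  rw [siteOp_pauliX_apply, opPow_pauliZ_apply, graphState_apply, graphState_apply, graphSign_add,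
    graphSign_bit, dotProduct_comm]
  ring

/-- If `u` and `v` are adjacent, an operator in the `XZ` plane acts on the graph state at `v` as
a combination of operators that act trivially at `v`. -/
theorem siteOp_xzPlane_graphState {u v : V} (huv : G.Adj u v) (θ : ℝ) :
    siteOp v (xzPlane θ) (graphState G) =
      (Real.cos θ : ℂ) • opPow (fun _ => pauliZ) (nbrBits G (bit v)) (graphState G) +
      (Real.sin θ : ℂ) • siteOp u pauliX
        (opPow (fun _ => pauliZ) (nbrBits G (bit u) + bit v) (graphState G)) := by
  have hZ : ∀ _ : V, pauliZ * pauliZ = 1 := fun _ => pauliZ_isPMObservable.2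
  have h2 : siteOp u pauliX (opPow (fun _ => pauliZ) (nbrBits G (bit u) + bit v) (graphState G)) =
      siteOp v pauliZ (graphState G) := by
    rw [add_comm, opPow_add hZ, opPow_bit, mul_apply_eq_comp, ← siteOp_pauliX_graphState,
      ← mul_apply_eq_comp, (siteOp_commute (ι := fun _ : V => ZMod 2) huv.ne pauliX pauliZ).eq,
      mul_apply_eq_comp,
      (IsPMObservable.siteOp (ι := fun _ : V => ZMod 2) (v := u)
        pauliX_isPMObservable).apply_apply]
  rw [h2, ← siteOp_pauliX_graphState, xzPlane, siteOp_add, siteOp_smul, siteOp_smul]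
  rfl

end Pauli

/-! ### Isometries with a finite ancilla register -/

section Stack

variable {α β γ : Type*} [Fintype β]

theorem stack_mem (e : γ ≃ β × α) (a : β → L2 α) :
    Memℓp (fun c => a (e c).1 (e c).2) 2 := by
  rw [memL2_iff]
  have h : Summable fun z : β × α => ‖a z.1 z.2‖ ^ 2 :=
    (summable_prod_of_nonneg fun _ => by positivity).2
      ⟨fun b => summable_sq (a b), summable_of_hasFiniteSupport (Set.toFinite _)⟩
  exact e.summable_iff.2 h

/-- The vector `∑ b, |b⟩ ⊗ a b`, for an identification `e` of the labels of the target space with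
pairs of labels. -/
noncomputable def stack (e : γ ≃ β × α) (a : β → L2 α) : L2 γ :=
  ⟨fun c => a (e c).1 (e c).2, stack_mem e a⟩

theorem stack_apply (e : γ ≃ β × α) (a : β → L2 α) (c : γ) :
    stack e a c = a (e c).1 (e c).2 := rfl

theorem stack_add (e : γ ≃ β × α) (a a' : β → L2 α) :
    stack e (a + a') = stack e a + stack e a' := rfl

theorem stack_sub (e : γ ≃ β × α) (a a' : β → L2 α) :
    stack e (a - a') = stack e a - stack e a' := rfl

theorem stack_smul (e : γ ≃ β × α) (c : ℂ) (a : β → L2 α) :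
    stack e (c • a) = c • stack e a := rfl

theorem inner_stack (e : γ ≃ β × α) (a a' : β → L2 α) :
    inner ℂ (stack e a) (stack e a') = ∑ b, inner ℂ (a b) (a' b) := by
  have hs := (e.symm.summable_iff).2 (lp.summable_inner (𝕜 := ℂ) (stack e a) (stack e a'))
  rw [lp.inner_eq_tsum, ← e.symm.tsum_eq]
  refine (Summable.tsum_prod hs).trans ?_
  rw [tsum_fintype]
  refine Finset.sum_congr rfl fun b _ => ?_
  rw [lp.inner_eq_tsum]
  refine tsum_congr fun i => ?_
  rw [Function.comp_apply, stack_apply, stack_apply, e.apply_symm_apply]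

theorem norm_stack_sq (e : γ ≃ β × α) (a : β → L2 α) : ‖stack e a‖ ^ 2 = ∑ b, ‖a b‖ ^ 2 := by
  have h := inner_stack e a a
  simp only [inner_self_eq_norm_sq_to_K] at h
  exact_mod_cast h

/-- The norm of a stacked vector is invariant under permuting the register and under phases. -/
theorem norm_stack_congr (e : γ ≃ β × α) (σ : Equiv.Perm β) (c : β → ℂ) (hc : ∀ b, ‖c b‖ = 1)
    (a a' : β → L2 α) (h : ∀ b, a b = c b • a' (σ b)) : ‖stack e a‖ = ‖stack e a'‖ := by
  rw [← sq_eq_sq₀ (norm_nonneg _) (norm_nonneg _), norm_stack_sq, norm_stack_sq,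
    ← Equiv.sum_comp σ fun b => ‖a' b‖ ^ 2]
  refine Finset.sum_congr rfl fun b _ => ?_
  rw [h, norm_smul, hc, one_mul]

/-- The isometry `f ↦ ∑ b, |b⟩ ⊗ K b f` defined by Kraus operators `K b`. -/
noncomputable def krausIsometry (e : γ ≃ β × α) (K : β → L2 α →L[ℂ] L2 α)
    (hK : ∑ b, adjoint (K b) * K b = 1) : L2 α →ₗᵢ[ℂ] L2 γ where
  toFun f := stack e fun b => K b f
  map_add' f g := by
    rw [← stack_add]
    congr 1
    funext b
    exact map_add _ _ _
  map_smul' c f := by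
    rw [RingHom.id_apply, ← stack_smul]
    congr 1
    funext b
    exact map_smul _ _ _
  norm_map' f := by
    have h : inner ℂ (stack e fun b => K b f) (stack e fun b => K b f) = inner ℂ f f := by
      rw [inner_stack]
      calc ∑ b, inner ℂ (K b f) (K b f) = inner ℂ f ((∑ b, adjoint (K b) * K b) f) := by
            rw [sum_apply, inner_sum]
            exact Finset.sum_congr rfl fun b _ => by
              rw [mul_apply_eq_comp, adjoint_inner_right]
        _ = inner ℂ f f := by rw [hK]; rfl
    simp only [inner_self_eq_norm_sq_to_K] at h
    have h' : ‖stack e fun b => K b f‖ ^ 2 = ‖f‖ ^ 2 := by exact_mod_cast h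
    exact (sq_eq_sq₀ (norm_nonneg _) (norm_nonneg _)).1 h'

theorem krausIsometry_apply (e : γ ≃ β × α) (K : β → L2 α →L[ℂ] L2 α)
    (hK : ∑ b, adjoint (K b) * K b = 1) (f : L2 α) :
    krausIsometry e K hK f = stack e fun b => K b f := rfl

end Stack

/-! ### The swap isometry -/

section Swap

variable {α : Type*} {X Z : L2 α →L[ℂ] L2 α}

/-- The operator `⟨b|` applied to the output `½ ((1 + X) f ⊗ |+⟩ + Z (1 - X) f ⊗ |-⟩)` of the
swap circuit on one subsystem. -/
noncomputable def swapKraus (X Z : L2 α →L[ℂ] L2 α) (b : ZMod 2) : L2 α →L[ℂ] L2 α :=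
  ((1 / (2 * Real.sqrt 2) : ℝ) : ℂ) • ((1 + X) + zsign b • (Z * (1 - X)))

/-- The compression of the qubit operator `Z` by the swap isometry. -/
noncomputable def swapZ (X Z : L2 α →L[ℂ] L2 α) : L2 α →L[ℂ] L2 α := (1 / 2 : ℂ) • (Z - X * Z * X)

/-- The swap isometry intertwines the observable `X` with the qubit operator `X`. -/
theorem swapKraus_mul (hX : IsPMObservable X) (b : ZMod 2) :
    swapKraus X Z b * X = swapKraus X Z (b + 1) := by
  simp only [swapKraus, smul_mul_assoc, add_mul, mul_assoc, sub_mul, hX.2, one_mul, zsign_add,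
    zsign_one, mul_sub, mul_one]
  module

theorem adjoint_swapKraus (hX : IsPMObservable X) (hZ : IsPMObservable Z) (b : ZMod 2) :
    adjoint (swapKraus X Z b) =
      ((1 / (2 * Real.sqrt 2) : ℝ) : ℂ) • ((1 + X) + zsign b • ((1 - X) * Z)) := by
  rw [← ContinuousLinearMap.star_eq_adjoint, swapKraus, star_smul, star_add, star_smul, star_mul,
    star_add, star_sub, star_one, hX.1.star_eq, hZ.1.star_eq]
  simp

theorem swapKraus_sum (hX : IsPMObservable X) (hZ : IsPMObservable Z) (p : ZMod 2) :
    ∑ b, zsign (p * b) • (adjoint (swapKraus X Z b) * swapKraus X Z b) =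
      swapZ X Z ^ p.val := by
  have hc : ((1 / (2 * Real.sqrt 2) : ℝ) : ℂ) * ((1 / (2 * Real.sqrt 2) : ℝ) : ℂ) = 1 / 8 := by
    rw [← Complex.ofReal_mul]
    have : 1 / (2 * Real.sqrt 2) * (1 / (2 * Real.sqrt 2)) = 1 / 8 := by
      rw [div_mul_div_comm, mul_mul_mul_comm, Real.mul_self_sqrt (by norm_num)]
      norm_num
    rw [this]
    norm_num
  have hzz : ∀ A : L2 α →L[ℂ] L2 α, Z * (Z * A) = A := fun A => by
    rw [← mul_assoc, hZ.2, one_mul]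
  have hK : ∀ b, adjoint (swapKraus X Z b) * swapKraus X Z b = (1 / 8 : ℂ) •
      (((1 + X) + zsign b • ((1 - X) * Z)) * ((1 + X) + zsign b • (Z * (1 - X)))) := fun b => by
    rw [adjoint_swapKraus hX hZ, swapKraus, smul_mul_smul_comm, hc]
  simp only [sum_zmod_two, hK]
  rcases zmod_two_cases p with rfl | rfl
  · simp only [zero_mul, zsign_zero, zsign_one, ZMod.val_zero, pow_zero, one_smul, mul_one,
      add_mul, mul_add, sub_mul, mul_sub, one_mul, mul_assoc, smul_mul_assoc, mul_smul_comm,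
      hX.2, hZ.2, hzz]
    module
  · simp only [zsign_zero, zsign_one, val_one_zmod_two, pow_one, one_smul, mul_one, mul_zero,
      add_mul, mul_add, sub_mul, mul_sub, one_mul, mul_assoc, smul_mul_assoc, mul_smul_comm,
      hX.2, hZ.2, hzz, swapZ]
    module

variable {V : Type*} {ι : V → Type*}

/-- Collecting the ancilla labels and the qubit labels of all subsystems. -/
noncomputable def splitQubits (ι : V → Type*) :
    (∀ v, ι v × ZMod 2) ≃ (V → ZMod 2) × (∀ v, ι v) where
  toFun x := (fun v => (x v).2, fun v => (x v).1)
  invFun y v := (y.2 v, y.1 v)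
  left_inv _ := rfl
  right_inv _ := rfl

theorem tensor_eq_stack [Fintype V] [DecidableEq V] (a : Joint ι) (g : Joint fun _ : V => ZMod 2) :
    tensor a g = stack (splitQubits ι) fun b => g b • a := by
  apply lp.ext
  funext x
  exact mul_comm _ _

variable [Fintype V] [DecidableEq V] {X Z : ∀ v, L2 (ι v) →L[ℂ] L2 (ι v)}

theorem opProd_swapKraus_sum (hX : ∀ v, IsPMObservable (X v)) (hZ : ∀ v, IsPMObservable (Z v))
    (p : V → ZMod 2) :
    ∑ b : V → ZMod 2, zsign (p ⬝ᵥ b) • (adjoint (opProd fun v => swapKraus (X v) (Z v) (b v)) *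
        opProd fun v => swapKraus (X v) (Z v) (b v)) =
      opPow (fun v => swapZ (X v) (Z v)) p := by
  rw [opPow_eq_opProd]
  simp only [← swapKraus_sum (hX _) (hZ _)]
  rw [opProd_sum]
  refine Finset.sum_congr rfl fun b _ => ?_
  rw [opProd_smul, ← opProd_adjoint, ← map_mul, dotProduct, zsign_sum]
  rfl

/-- The global swap isometry, the tensor product of the swap isometries of all subsystems;
the ancilla of each subsystem is a copy of that subsystem. -/
noncomputable def swapIsometry (hX : ∀ v, IsPMObservable (X v))
    (hZ : ∀ v, IsPMObservable (Z v)) :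
    Joint ι →ₗᵢ[ℂ] Joint fun v => ι v × ZMod 2 :=
  krausIsometry (splitQubits ι) (fun b => opProd fun v => swapKraus (X v) (Z v) (b v)) (by
    have h := opProd_swapKraus_sum hX hZ 0
    simpa only [zero_dotProduct, zsign_zero, one_smul, opPow_zero] using h)

theorem swapIsometry_isLocal (hX : ∀ v, IsPMObservable (X v)) (hZ : ∀ v, IsPMObservable (Z v)) :
    IsLocalIsometry (swapIsometry hX hZ) := by
  refine ⟨fun v => krausIsometry (Equiv.prodComm _ _) (swapKraus (X v) (Z v)) ?_, fun f => ?_⟩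
  · have h := swapKraus_sum (hX v) (hZ v) 0
    simpa only [zero_mul, zsign_zero, one_smul, ZMod.val_zero, pow_zero] using h
  · apply lp.ext
    funext x
    change opProd (fun v => swapKraus (X v) (Z v) (x v).2) (prodVec f) (fun v => (x v).1) = _
    rw [opProd_prodVec]
    rfl

theorem opProd_swapKraus_opPow (hX : ∀ v, IsPMObservable (X v)) (b q : V → ZMod 2) (f : Joint ι) :
    opProd (fun v => swapKraus (X v) (Z v) (b v)) (opPow X q f) =
      opProd (fun v => swapKraus (X v) (Z v) ((b + q) v)) f := by
  rw [opPow_eq_opProd, ← mul_apply_eq_comp, ← map_mul]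
  congr 2
  funext v
  change swapKraus (X v) (Z v) (b v) * X v ^ (q v).val = _
  rcases zmod_two_cases (q v) with h | h
  · simp [h]
  · rw [h, val_one_zmod_two, pow_one, swapKraus_mul (hX v), Pi.add_apply, h]

/-- The matrix elements of the qubit operators `Z ^ p` between vectors in the range of the swap
isometry. -/
theorem sum_inner_swapKraus (hX : ∀ v, IsPMObservable (X v)) (hZ : ∀ v, IsPMObservable (Z v))
    (p : V → ZMod 2) (f g : Joint ι) :
    ∑ b : V → ZMod 2, zsign (p ⬝ᵥ b) *
        inner ℂ (opProd (fun v => swapKraus (X v) (Z v) (b v)) f)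
          (opProd (fun v => swapKraus (X v) (Z v) (b v)) g) =
      inner ℂ f (opPow (fun v => swapZ (X v) (Z v)) p g) := by
  rw [← opProd_swapKraus_sum hX hZ, sum_apply, inner_sum]
  refine Finset.sum_congr rfl fun b _ => ?_
  rw [smul_apply, inner_smul_right, mul_apply_eq_comp, adjoint_inner_right]

end Swap

/-! ### Unit vectors -/

section Unit

variable {E : Type*} [NormedAddCommGroup E] [InnerProductSpace ℂ E] {a b : E}

theorem norm_sub_sq_of_unit (ha : ‖a‖ = 1) (hb : ‖b‖ = 1) :
    ‖a - b‖ ^ 2 = 2 - 2 * (inner ℂ a b).re := by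
  have h := norm_sub_sq (𝕜 := ℂ) a b
  rw [ha, hb] at h
  rw [h, RCLike.re_eq_complex_re]
  ring

theorem norm_sub_le_sqrt_of_unit (ha : ‖a‖ = 1) (hb : ‖b‖ = 1) {c : ℝ}
    (h : 1 - c ≤ (inner ℂ a b).re) : ‖a - b‖ ≤ Real.sqrt (2 * c) := by
  refine Real.le_sqrt_of_sq_le ?_
  rw [norm_sub_sq_of_unit ha hb]
  linarith

theorem re_inner_ge_of_norm_sub_le (ha : ‖a‖ = 1) {c : ℝ} (h : ‖a - b‖ ≤ c) :
    1 - c ≤ (inner ℂ a b).re := by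
  have h1 : inner ℂ a b = 1 - inner ℂ a (a - b) := by
    rw [inner_sub_right, inner_self_eq_norm_sq_to_K, ha]
    simp
  have h2 : (inner ℂ a (a - b)).re ≤ c := by
    refine (Complex.re_le_norm _).trans ((norm_inner_le_norm a (a - b)).trans ?_)
    rwa [ha, one_mul]
  rw [h1, Complex.sub_re, Complex.one_re]
  linarith

theorem exists_unit_inner_eq_norm (ha : ‖a‖ = 1) (b : E) :
    ∃ c : E, ‖c‖ = 1 ∧ inner ℂ c b = (‖b‖ : ℂ) := by
  by_cases hb : b = 0
  · exact ⟨a, ha, by simp [hb]⟩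
  · have hb' : (‖b‖ : ℂ) ≠ 0 := by simpa using hb
    refine ⟨((‖b‖ : ℂ)⁻¹) • b, ?_, ?_⟩
    · rw [norm_smul, norm_inv, Complex.norm_real, norm_norm, inv_mul_cancel₀ (by simpa using hb)]
    · rw [inner_smul_left, inner_self_eq_norm_sq_to_K, map_inv₀, Complex.conj_ofReal]
      change (‖b‖ : ℂ)⁻¹ * (‖b‖ : ℂ) ^ 2 = (‖b‖ : ℂ)
      field_simp

end Unit

/-! ### Approximate stabilizers and anticommutation -/

section Anticommute

variable {V : Type*} [DecidableEq V]

theorem indicatorBits_triangle {a b c : V} (hab : a ≠ b) (hac : a ≠ c) (hbc : b ≠ c) :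
    indicatorBits {a, b, c} = bit a + bit b + bit c := by
  funext y
  simp only [indicatorBits, Finset.mem_insert, Finset.mem_singleton, bit, Pi.add_apply]
  by_cases h1 : y = a
  · subst h1; simp [hab, hac]
  by_cases h2 : y = b
  · subst h2; simp [h1, hbc]
  by_cases h3 : y = c
  · subst h3; simp [h1, h2]
  simp [h1, h2, h3]

variable [Fintype V] {G : SimpleGraph V} [DecidableRel G.Adj]
  {ι : V → Type*} {X Z : ∀ v, L2 (ι v) →L[ℂ] L2 (ι v)}

/-- In the product of the triangle operator with the three vertex operators of a triangle, all
factors cancel except at the vertex whose operator stands in the middle. -/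
theorem triangle_mul_vertices (hX : ∀ v, X v * X v = 1) (hZ : ∀ v, Z v * Z v = 1) {a b c : V}
    (hab : G.Adj a b) (hac : G.Adj a c) (hbc : G.Adj b c) :
    opPow X (indicatorBits {a, b, c}) * opPow Z (nbrBits G (indicatorBits {a, b, c})) *
        (siteOp b (X b) * opPow Z (nbrBits G (bit b))) *
        (siteOp a (X a) * opPow Z (nbrBits G (bit a))) *
        (siteOp c (X c) * opPow Z (nbrBits G (bit c))) =
      siteOp a (X a * Z a * X a * Z a) := by
  rw [indicatorBits_triangle hab.ne hac.ne hbc.ne, nbrBits_add, nbrBits_add]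
  simp only [← opPow_bit, opPow_eq_opProd, ← map_mul]
  rw [← opProd_mulSingle]
  congr 1
  funext y
  simp only [Pi.mul_apply, Pi.add_apply, nbrBits_bit_apply]
  by_cases ha : y = a
  · subst ha
    simp [bit, hab, hac, hab.ne, hac.ne, CharTwo.add_self_eq_zero, val_one_zmod_two, mul_assoc]
  by_cases hb : y = b
  · subst hb
    simp [bit, hab.symm, hbc, ha, hbc.ne, CharTwo.add_self_eq_zero, val_one_zmod_two, hX, hZ]
  by_cases hc : y = c
  · subst hc
    simp [bit, hac.symm, hbc.symm, ha, hb, CharTwo.add_self_eq_zero, val_one_zmod_two,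
      mul_assoc, hX, hZ]
  · by_cases h1 : G.Adj y a <;> by_cases h2 : G.Adj y b <;> by_cases h3 : G.Adj y c <;>
      simp [bit, ha, hb, hc, h1, h2, h3, CharTwo.add_self_eq_zero, val_one_zmod_two, hZ]

/-- As the triangle operator acts on the state approximately as `-1` and the vertex operators
approximately as `1`, their product shows that `X` and `Z` approximately anticommute on the state
at the vertex `a` of the triangle. -/
theorem norm_anticommutator_le_of_triangle (hX : ∀ v, IsPMObservable (X v))
    (hZ : ∀ v, IsPMObservable (Z v)) {ψ : Joint ι} {η : ℝ}
    (hstab : ∀ v, ‖(siteOp v (X v) * opPow Z (nbrBits G (bit v))) ψ - ψ‖ ≤ η) {a b c : V}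
    (hab : G.Adj a b) (hac : G.Adj a c) (hbc : G.Adj b c)
    (htri : ‖(opPow X (indicatorBits {a, b, c}) *
      opPow Z (nbrBits G (indicatorBits {a, b, c}))) ψ + ψ‖ ≤ η) :
    ‖siteOp a (X a) (siteOp a (Z a) ψ) + siteOp a (Z a) (siteOp a (X a) ψ)‖ ≤ 4 * η := by
  have hmul := triangle_mul_vertices (fun v => (hX v).2) (fun v => (hZ v).2) hab hac hbc
  set T := opPow X (indicatorBits {a, b, c}) * opPow Z (nbrBits G (indicatorBits {a, b, c}))
  set S := fun v => siteOp v (X v) * opPow Z (nbrBits G (bit v))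
  change T * S b * S a * S c = _ at hmul
  have hS : ∀ v f, ‖S v f‖ = ‖f‖ := fun v f => by
    change ‖siteOp v (X v) (opPow Z (nbrBits G (bit v)) f)‖ = _
    rw [(hX v).siteOp.norm_apply, (IsPMObservable.opPow hZ _).norm_apply]
  have hT : ∀ f, ‖T f‖ = ‖f‖ := fun f => by
    change ‖opPow X _ (opPow Z _ f)‖ = _
    rw [(IsPMObservable.opPow hX _).norm_apply, (IsPMObservable.opPow hZ _).norm_apply]
  have h1 : siteOp a (X a * Z a * X a * Z a) ψ + ψ =
      T (S b (S a (S c ψ - ψ))) + T (S b (S a ψ - ψ)) + T (S b ψ - ψ) + (T ψ + ψ) := by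
    rw [← hmul]
    simp only [mul_apply_eq_comp, map_sub]
    abel
  have h2 : ‖siteOp a (X a * Z a * X a * Z a) ψ + ψ‖ ≤ 4 * η := by
    rw [h1]
    refine (norm_add₄_le).trans ?_
    rw [hT, hT, hT, hS, hS, hS]
    linarith [hstab a, hstab b, hstab c]
  have h3 : siteOp a (X a * Z a * X a * Z a) ψ + ψ = siteOp a (X a) (siteOp a (Z a)
      (siteOp a (X a) (siteOp a (Z a) ψ) + siteOp a (Z a) (siteOp a (X a) ψ))) := by
    rw [map_add, map_add, (hZ a).siteOp.apply_apply, (hX a).siteOp.apply_apply]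
    simp only [siteOp_mul, mul_apply_eq_comp]
  rwa [h3, (hX a).siteOp.norm_apply, (hZ a).siteOp.norm_apply] at h2

/-- If every vertex lies in a triangle, then `X` and `Z` approximately anticommute everywhere. -/
theorem norm_anticommutator_le (hG : ∀ v, ∃ T : Finset V, v ∈ T ∧ G.IsNClique 3 T)
    (hX : ∀ v, IsPMObservable (X v)) (hZ : ∀ v, IsPMObservable (Z v)) {ψ : Joint ι} {η : ℝ}
    (hstab : ∀ v, ‖(siteOp v (X v) * opPow Z (nbrBits G (bit v))) ψ - ψ‖ ≤ η)
    (htri : ∀ T : Finset V, G.IsNClique 3 T →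
      ‖(opPow X (indicatorBits T) * opPow Z (nbrBits G (indicatorBits T))) ψ + ψ‖ ≤ η) (v : V) :
    ‖siteOp v (X v) (siteOp v (Z v) ψ) + siteOp v (Z v) (siteOp v (X v) ψ)‖ ≤ 4 * η := by
  obtain ⟨T, hv, hT⟩ := hG v
  have key : ∀ a b c, G.Adj a b → G.Adj a c → G.Adj b c →
      ‖siteOp a (X a) (siteOp a (Z a) ψ) + siteOp a (Z a) (siteOp a (X a) ψ)‖ ≤ 4 * η :=
    fun a b c hab hac hbc => norm_anticommutator_le_of_triangle hX hZ hstab hab hac hbc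
      (htri _ (SimpleGraph.is3Clique_iff.2 ⟨a, b, c, hab, hac, hbc, rfl⟩))
  obtain ⟨a, b, c, hab, hac, hbc, rfl⟩ := SimpleGraph.is3Clique_iff.1 hT
  simp only [Finset.mem_insert, Finset.mem_singleton] at hv
  rcases hv with rfl | rfl | rfl
  · exact key _ _ _ hab hac hbc
  · exact key _ _ _ hab.symm hbc hac
  · exact key _ _ _ hac.symm hbc.symm hab

end Anticommute

section Estimates

variable {V : Type*} [DecidableEq V]
  {ι : V → Type*} {X Z : ∀ v, L2 (ι v) →L[ℂ] L2 (ι v)} {ψ : Joint ι} {η : ℝ}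

theorem siteOp_swapZ_apply (v : V) (f : Joint ι) :
    siteOp v (swapZ (X v) (Z v)) f =
      (1 / 2 : ℂ) • (siteOp v (Z v) f - siteOp v (X v) (siteOp v (Z v) (siteOp v (X v) f))) := by
  rw [swapZ, siteOp_smul, siteOp_sub, siteOp_mul, siteOp_mul]
  rfl

theorem norm_siteOp_swapZ_le (hX : ∀ v, IsPMObservable (X v)) (hZ : ∀ v, IsPMObservable (Z v))
    (v : V) (f : Joint ι) : ‖siteOp v (swapZ (X v) (Z v)) f‖ ≤ ‖f‖ := by
  rw [siteOp_swapZ_apply, norm_smul]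
  have h := norm_sub_le (siteOp v (Z v) f) (siteOp v (X v) (siteOp v (Z v) (siteOp v (X v) f)))
  rw [(hZ v).siteOp.norm_apply, (hX v).siteOp.norm_apply, (hZ v).siteOp.norm_apply,
    (hX v).siteOp.norm_apply] at h
  norm_num
  linarith

theorem norm_siteOp_swapZ_sub_le (hX : ∀ v, IsPMObservable (X v)) {v : V}
    (hanti : ‖siteOp v (X v) (siteOp v (Z v) ψ) + siteOp v (Z v) (siteOp v (X v) ψ)‖ ≤ 4 * η) :
    ‖siteOp v (swapZ (X v) (Z v) - Z v) ψ‖ ≤ 2 * η := by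
  have h : siteOp v (swapZ (X v) (Z v) - Z v) ψ = (-1 / 2 : ℂ) • siteOp v (X v)
      (siteOp v (X v) (siteOp v (Z v) ψ) + siteOp v (Z v) (siteOp v (X v) ψ)) := by
    rw [siteOp_sub, sub_apply, siteOp_swapZ_apply, map_add, (hX v).siteOp.apply_apply]
    module
  rw [h, norm_smul, (hX v).siteOp.norm_apply]
  norm_num
  linarith

variable [Fintype V]

/-- On the state, the compressed qubit operators `Z ^ p` are close to the observables. -/
theorem norm_opPow_swapZ_sub_le (hX : ∀ v, IsPMObservable (X v)) (hZ : ∀ v, IsPMObservable (Z v))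
    (hanti : ∀ v, ‖siteOp v (X v) (siteOp v (Z v) ψ) + siteOp v (Z v) (siteOp v (X v) ψ)‖ ≤ 4 * η)
    (p : V → ZMod 2) :
    ‖opPow (fun v => swapZ (X v) (Z v)) p ψ - opPow Z p ψ‖ ≤ 2 * bitDot p p * η := by
  induction p using bits_induction with
  | zero => simp [opPow_zero, bitDot]
  | step v p hp ih =>
    have h : opPow (fun v => swapZ (X v) (Z v)) (p + bit v) ψ - opPow Z (p + bit v) ψ =
        siteOp v (swapZ (X v) (Z v)) (opPow (fun v => swapZ (X v) (Z v)) p ψ - opPow Z p ψ) +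
        opPow Z p (siteOp v (swapZ (X v) (Z v) - Z v) ψ) := by
      rw [← mul_apply_eq_comp (opPow Z p), ← (siteOp_commute_opPow hp _).eq, opPow_bit_add hp,
        opPow_bit_add hp, mul_apply_eq_comp, mul_apply_eq_comp, mul_apply_eq_comp, siteOp_sub,
        sub_apply, map_sub]
      abel
    rw [h, bitDot_self_add_bit hp, Nat.cast_add, Nat.cast_one]
    have h1 := norm_add_le
      (siteOp v (swapZ (X v) (Z v)) (opPow (fun v => swapZ (X v) (Z v)) p ψ - opPow Z p ψ))
      (opPow Z p (siteOp v (swapZ (X v) (Z v) - Z v) ψ))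
    have h2 := norm_siteOp_swapZ_le hX hZ v
      (opPow (fun v => swapZ (X v) (Z v)) p ψ - opPow Z p ψ)
    have h3 := norm_siteOp_swapZ_sub_le hX (hanti v)
    rw [(IsPMObservable.opPow hZ p).norm_apply] at h1
    linarith

/-- Moving one `X` through a string of `Z`s costs at most one anticommutation. -/
theorem norm_siteOp_opPow_sub_le (hZ : ∀ v, IsPMObservable (Z v)) {v : V} (hη : 0 ≤ η)
    (hanti : ‖siteOp v (X v) (siteOp v (Z v) ψ) + siteOp v (Z v) (siteOp v (X v) ψ)‖ ≤ 4 * η)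
    (p : V → ZMod 2) :
    ‖siteOp v (X v) (opPow Z p ψ) - zsign (p v) • opPow Z p (siteOp v (X v) ψ)‖ ≤ 4 * η := by
  rcases zmod_two_cases (p v) with h | h
  · rw [h, zsign_zero, one_smul, ← mul_apply_eq_comp, (siteOp_commute_opPow h _).eq,
      mul_apply_eq_comp, sub_self, norm_zero]
    positivity
  · obtain ⟨p', hp', rfl⟩ : ∃ p', p' v = 0 ∧ p = bit v + p' :=
      ⟨bit v + p, by simp [bit, h, CharTwo.add_self_eq_zero], by
        rw [← add_assoc, bits_add_self, zero_add]⟩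
    have hc : ∀ f, siteOp v (X v) (opPow Z p' f) = opPow Z p' (siteOp v (X v) f) := fun f => by
      rw [← mul_apply_eq_comp, (siteOp_commute_opPow hp' _).eq, mul_apply_eq_comp]
    have hz : ∀ f, opPow Z (bit v + p') f = opPow Z p' (siteOp v (Z v) f) := fun f => by
      rw [add_comm, opPow_add fun v => (hZ v).2, opPow_bit, mul_apply_eq_comp]
    rw [h, zsign_one, hz, hz, hc, neg_one_smul, sub_neg_eq_add, ← map_add,
      (IsPMObservable.opPow hZ p').norm_apply]
    exact hanti

/-- On the state, `X ^ x` acts as it does on the graph state. -/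
theorem norm_opPow_sub_graphSign_smul_le (G : SimpleGraph V) [DecidableRel G.Adj]
    (hX : ∀ v, IsPMObservable (X v)) (hZ : ∀ v, IsPMObservable (Z v)) (hη : 0 ≤ η)
    (hanti : ∀ v, ‖siteOp v (X v) (siteOp v (Z v) ψ) + siteOp v (Z v) (siteOp v (X v) ψ)‖ ≤ 4 * η)
    (hstab : ∀ v, ‖siteOp v (X v) ψ - opPow Z (nbrBits G (bit v)) ψ‖ ≤ η) (x : V → ZMod 2) :
    ‖opPow X x ψ - graphSign G x • opPow Z (nbrBits G x) ψ‖ ≤ 5 * bitDot x x * η := by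
  induction x using bits_induction with
  | zero =>
    have h : nbrBits G 0 = 0 := Matrix.mulVec_zero _
    simp [opPow_zero, bitDot, graphSign_zero, h]
  | step v x hx ih =>
    have hs : graphSign G (x + bit v) = graphSign G x * zsign (nbrBits G x v) := by
      rw [add_comm, graphSign_add, graphSign_bit, bit_dotProduct, one_mul]
    have h : opPow X (x + bit v) ψ - graphSign G (x + bit v) • opPow Z (nbrBits G (x + bit v)) ψ =
        siteOp v (X v) (opPow X x ψ - graphSign G x • opPow Z (nbrBits G x) ψ) +
        graphSign G x • (siteOp v (X v) (opPow Z (nbrBits G x) ψ) -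
          zsign (nbrBits G x v) • opPow Z (nbrBits G x) (siteOp v (X v) ψ)) +
        (graphSign G x * zsign (nbrBits G x v)) • opPow Z (nbrBits G x)
          (siteOp v (X v) ψ - opPow Z (nbrBits G (bit v)) ψ) := by
      rw [hs, nbrBits_add, opPow_add (fun v => (hZ v).2), opPow_bit_add hx, mul_apply_eq_comp,
        mul_apply_eq_comp, map_sub, map_sub, map_smul]
      module
    rw [h, bitDot_self_add_bit hx, Nat.cast_add, Nat.cast_one]
    refine (norm_add₃_le).trans ?_
    rw [norm_smul, norm_smul, norm_mul, norm_graphSign, norm_zsign, (hX v).siteOp.norm_apply,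
      (IsPMObservable.opPow hZ _).norm_apply]
    linarith [hstab v, norm_siteOp_opPow_sub_le hZ hη (hanti v) (nbrBits G x)]

end Estimates

/-! ### The image of the state under the swap isometry -/

section Extraction

theorem tensor_add {V : Type*} {ι κ : V → Type*} (a : Joint ι) (g h : Joint κ) :
    tensor a (g + h) = tensor a g + tensor a h := by
  apply lp.ext
  funext x
  exact mul_add _ _ _

theorem tensor_smul {V : Type*} {ι κ : V → Type*} (a : Joint ι) (c : ℂ) (g : Joint κ) :
    tensor a (c • g) = c • tensor a g := by
  apply lp.ext
  funext x
  exact mul_left_comm _ _ _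

variable {V : Type*} [Fintype V] [DecidableEq V]
  {ι : V → Type*} {X Z : ∀ v, L2 (ι v) →L[ℂ] L2 (ι v)} {ψ : Joint ι} {η : ℝ}

theorem norm_tensor (a : Joint ι) (g : Joint fun _ : V => ZMod 2) :
    ‖tensor a g‖ = ‖g‖ * ‖a‖ := by
  rw [← sq_eq_sq₀ (norm_nonneg _) (by positivity), tensor_eq_stack, norm_stack_sq, mul_pow,
    norm_sq_eq_tsum g, tsum_fintype, Finset.sum_mul]
  exact Finset.sum_congr rfl fun b _ => by rw [norm_smul, mul_pow]

/-- The partial inner product of the image of the state under the swap isometry with the graph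
state. -/
noncomputable def junkVector (G : SimpleGraph V) [DecidableRel G.Adj]
    (X Z : ∀ v, L2 (ι v) →L[ℂ] L2 (ι v)) (ψ : Joint ι) : Joint ι :=
  ∑ b, graphState G b • opProd (fun v => swapKraus (X v) (Z v) (b v)) ψ

variable (G : SimpleGraph V) [DecidableRel G.Adj]

theorem inner_tensor_swapIsometry (hX : ∀ v, IsPMObservable (X v))
    (hZ : ∀ v, IsPMObservable (Z v)) (a : Joint ι) :
    inner ℂ (tensor a (graphState G)) (swapIsometry hX hZ ψ) =
      inner ℂ a (junkVector G X Z ψ) := by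
  rw [tensor_eq_stack, swapIsometry, krausIsometry_apply, inner_stack, junkVector, inner_sum]
  refine Finset.sum_congr rfl fun b _ => ?_
  rw [inner_smul_left, inner_smul_right, graphState_apply, map_div₀, conj_graphSign,
    Complex.conj_ofReal]

/-- The weight of the graph state in the image of the state is the average of the expectations of
the stabilizers of the graph state, pulled back to the original space. -/
theorem inner_junkVector (hX : ∀ v, IsPMObservable (X v)) (hZ : ∀ v, IsPMObservable (Z v)) :
    inner ℂ (junkVector G X Z ψ) (junkVector G X Z ψ) =
      ((2 : ℂ) ^ Fintype.card V)⁻¹ * ∑ x : V → ZMod 2, graphSign G x *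
        inner ℂ (opPow X x ψ) (opPow (fun v => swapZ (X v) (Z v)) (nbrBits G x) ψ) := by
  have hr : (Real.sqrt (2 ^ Fintype.card V) : ℂ)⁻¹ * (Real.sqrt (2 ^ Fintype.card V) : ℂ)⁻¹ =
      ((2 : ℂ) ^ Fintype.card V)⁻¹ := by
    rw [← mul_inv, ← Complex.ofReal_mul, Real.mul_self_sqrt (by positivity)]
    norm_num
  set K : (V → ZMod 2) → Joint ι →L[ℂ] Joint ι :=
    fun b => opProd fun v => swapKraus (X v) (Z v) (b v) with hK
  have h1 : inner ℂ (junkVector G X Z ψ) (junkVector G X Z ψ) =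
      ∑ c, ∑ b, ((2 : ℂ) ^ Fintype.card V)⁻¹ *
        (graphSign G b * graphSign G c * inner ℂ (K b ψ) (K c ψ)) := by
    rw [junkVector, inner_sum]
    refine Finset.sum_congr rfl fun c _ => ?_
    rw [sum_inner]
    refine Finset.sum_congr rfl fun b _ => ?_
    rw [inner_smul_left, inner_smul_right, graphState_apply, graphState_apply, map_div₀,
      conj_graphSign, Complex.conj_ofReal, ← hr]
    ring
  rw [h1]
  -- Substituting `b = c + x` makes the sum over `c` an instance of `sum_inner_swapKraus`.
  have h2 : ∀ c, ∑ b, ((2 : ℂ) ^ Fintype.card V)⁻¹ *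
        (graphSign G b * graphSign G c * inner ℂ (K b ψ) (K c ψ)) =
      ∑ x, ((2 : ℂ) ^ Fintype.card V)⁻¹ * (graphSign G x *
        (zsign (nbrBits G x ⬝ᵥ c) * inner ℂ (K c (opPow X x ψ)) (K c ψ))) := by
    intro c
    rw [← Equiv.sum_comp (Equiv.addLeft c)]
    refine Finset.sum_congr rfl fun x _ => ?_
    rw [Equiv.coe_addLeft, graphSign_add, hK]
    simp only [opProd_swapKraus_opPow hX]
    rw [dotProduct_comm (nbrBits G x)]
    linear_combination ((2 : ℂ) ^ Fintype.card V)⁻¹ * graphSign G x *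
      zsign (c ⬝ᵥ nbrBits G x) * inner ℂ (opProd (fun v => swapKraus (X v) (Z v) ((c + x) v)) ψ)
        (opProd (fun v => swapKraus (X v) (Z v) (c v)) ψ) * graphSign_mul_self G c
  rw [Finset.sum_congr rfl fun c _ => h2 c, Finset.sum_comm, Finset.mul_sum]
  refine Finset.sum_congr rfl fun x _ => ?_
  rw [← sum_inner_swapKraus hX hZ, Finset.mul_sum, Finset.mul_sum]

theorem norm_junkVector_sq_ge (hψ : ‖ψ‖ = 1) (hX : ∀ v, IsPMObservable (X v))
    (hZ : ∀ v, IsPMObservable (Z v)) (hη : 0 ≤ η)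
    (hanti : ∀ v, ‖siteOp v (X v) (siteOp v (Z v) ψ) + siteOp v (Z v) (siteOp v (X v) ψ)‖ ≤ 4 * η)
    (hstab : ∀ v, ‖siteOp v (X v) ψ - opPow Z (nbrBits G (bit v)) ψ‖ ≤ η) :
    1 - 7 * Fintype.card V * η ≤ ‖junkVector G X Z ψ‖ ^ 2 := by
  have hx : ∀ x : V → ZMod 2, 1 - 7 * Fintype.card V * η ≤ (graphSign G x *
      inner ℂ (opPow X x ψ) (opPow (fun v => swapZ (X v) (Z v)) (nbrBits G x) ψ)).re := by
    intro x
    rw [← inner_smul_right]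
    refine re_inner_ge_of_norm_sub_le
      (by rw [(IsPMObservable.opPow hX x).norm_apply, hψ]) ?_
    have h1 := norm_opPow_sub_graphSign_smul_le G hX hZ hη hanti hstab x
    have h2 := norm_opPow_swapZ_sub_le hX hZ hanti (nbrBits G x)
    have h3 : opPow X x ψ - graphSign G x • opPow (fun v => swapZ (X v) (Z v)) (nbrBits G x) ψ =
        (opPow X x ψ - graphSign G x • opPow Z (nbrBits G x) ψ) - graphSign G x •
          (opPow (fun v => swapZ (X v) (Z v)) (nbrBits G x) ψ - opPow Z (nbrBits G x) ψ) := by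
      module
    rw [h3]
    refine (norm_sub_le _ _).trans ?_
    rw [norm_smul, norm_graphSign, one_mul]
    have h4 : (bitDot x x : ℝ) * η ≤ Fintype.card V * η :=
      mul_le_mul_of_nonneg_right (by exact_mod_cast bitDot_self_le x) hη
    have h5 : (bitDot (nbrBits G x) (nbrBits G x) : ℝ) * η ≤ Fintype.card V * η :=
      mul_le_mul_of_nonneg_right (by exact_mod_cast bitDot_self_le _) hη
    linarith
  have h := congrArg Complex.re (inner_junkVector (ψ := ψ) G hX hZ)
  rw [inner_self_eq_norm_sq_to_K] at h
  have hl : (((‖junkVector G X Z ψ‖ : ℂ)) ^ 2).re = ‖junkVector G X Z ψ‖ ^ 2 := by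
    rw [← Complex.ofReal_pow, Complex.ofReal_re]
  have hp : ((2 : ℂ) ^ Fintype.card V)⁻¹ = (((2 : ℝ) ^ Fintype.card V)⁻¹ : ℝ) := by norm_num
  have hsum := Finset.card_nsmul_le_sum Finset.univ _ _ fun x _ => hx x
  rw [Finset.card_univ, Fintype.card_fun, ZMod.card, nsmul_eq_mul, ← Complex.re_sum,
    Nat.cast_pow, Nat.cast_ofNat] at hsum
  rw [← hl]
  refine le_of_le_of_eq ?_ h.symm
  rw [hp, Complex.re_ofReal_mul, ← div_eq_inv_mul, le_div_iff₀ (by positivity), mul_comm]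
  exact hsum

/-- The swap isometry extracts the graph state from the given state. -/
theorem exists_junk (hψ : ‖ψ‖ = 1) (hX : ∀ v, IsPMObservable (X v))
    (hZ : ∀ v, IsPMObservable (Z v)) (hη : 0 ≤ η)
    (hanti : ∀ v, ‖siteOp v (X v) (siteOp v (Z v) ψ) + siteOp v (Z v) (siteOp v (X v) ψ)‖ ≤ 4 * η)
    (hstab : ∀ v, ‖siteOp v (X v) ψ - opPow Z (nbrBits G (bit v)) ψ‖ ≤ η) :
    ∃ junk : Joint ι, ‖junk‖ = 1 ∧
      ‖swapIsometry hX hZ ψ - tensor junk (graphState G)‖ ≤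
        Real.sqrt (14 * Fintype.card V * η) := by
  obtain ⟨junk, hj, hin⟩ := exists_unit_inner_eq_norm hψ (junkVector G X Z ψ)
  refine ⟨junk, hj, ?_⟩
  have hT : ‖tensor junk (graphState G)‖ = 1 := by rw [norm_tensor, norm_graphState, hj, one_mul]
  have hΦ : ‖swapIsometry hX hZ ψ‖ = 1 := by rw [LinearIsometry.norm_map, hψ]
  have h1 := norm_sub_sq_of_unit hT hΦ
  have h2 := norm_inner_le_norm (𝕜 := ℂ) (tensor junk (graphState G)) (swapIsometry hX hZ ψ)
  rw [inner_tensor_swapIsometry, hin] at h1 h2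
  rw [hT, hΦ, one_mul, Complex.norm_real, norm_norm] at h2
  rw [Complex.ofReal_re] at h1
  have h3 := norm_junkVector_sq_ge G hψ hX hZ hη hanti hstab
  rw [norm_sub_rev]
  refine Real.le_sqrt_of_sq_le ?_
  rw [h1]
  -- With `r = ‖junkVector‖ ≤ 1`: `2 - 2 r ≤ 2 - 2 r ^ 2 ≤ 14 n η`.
  nlinarith [norm_nonneg (junkVector G X Z ψ)]

/-- The qubit operators `Z ^ p` implement the observables up to an error depending on the number
of factors. -/
theorem norm_swapIsometry_opPow_sub_le (hψ : ‖ψ‖ = 1) (hX : ∀ v, IsPMObservable (X v))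
    (hZ : ∀ v, IsPMObservable (Z v))
    (hanti : ∀ v, ‖siteOp v (X v) (siteOp v (Z v) ψ) + siteOp v (Z v) (siteOp v (X v) ψ)‖ ≤ 4 * η)
    (p : V → ZMod 2) :
    ‖swapIsometry hX hZ (opPow Z p ψ) - stack (splitQubits ι) (fun b => zsign (p ⬝ᵥ b) •
      opProd (fun v => swapKraus (X v) (Z v) (b v)) ψ)‖ ≤
        Real.sqrt (2 * (2 * bitDot p p * η)) := by
  have hn : ‖opPow Z p ψ‖ = 1 := by rw [(IsPMObservable.opPow hZ p).norm_apply, hψ]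
  refine norm_sub_le_sqrt_of_unit (by rw [LinearIsometry.norm_map, hn]) ?_ ?_
  · refine (norm_stack_congr (splitQubits ι) (Equiv.refl _) (fun b => zsign (p ⬝ᵥ b))
      (fun _ => norm_zsign _) _ (fun b => opProd (fun v => swapKraus (X v) (Z v) (b v)) ψ)
      fun _ => rfl).trans ?_
    exact ((swapIsometry hX hZ).norm_map ψ).trans hψ
  · rw [swapIsometry, krausIsometry_apply, inner_stack]
    simp only [inner_smul_right]
    rw [sum_inner_swapKraus hX hZ]
    refine re_inner_ge_of_norm_sub_le hn ?_
    rw [norm_sub_rev]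
    exact norm_opPow_swapZ_sub_le hX hZ hanti p

/-- The error for `X ^ q Z ^ p` splits into the error of extracting the graph state and the error
of passing `Z ^ p` through the swap isometry; passing `X ^ q` is free. -/
theorem norm_swapIsometry_sub_le (hX : ∀ v, IsPMObservable (X v))
    (hZ : ∀ v, IsPMObservable (Z v)) (junk : Joint ι) (p q : V → ZMod 2) :
    ‖swapIsometry hX hZ ((opPow X q * opPow Z p) ψ) - tensor junk
        ((opPow (fun _ => pauliX) q * opPow (fun _ => pauliZ) p) (graphState G))‖ ≤
      ‖swapIsometry hX hZ (opPow Z p ψ) - stack (splitQubits ι) (fun b => zsign (p ⬝ᵥ b) •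
        opProd (fun v => swapKraus (X v) (Z v) (b v)) ψ)‖ +
      ‖swapIsometry hX hZ ψ - tensor junk (graphState G)‖ := by
  set K : (V → ZMod 2) → Joint ι →L[ℂ] Joint ι :=
    fun b => opProd fun v => swapKraus (X v) (Z v) (b v)
  have hΦ : ∀ f, swapIsometry hX hZ f = stack (splitQubits ι) fun b => K b f := fun _ => rfl
  have hphase : ‖stack (splitQubits ι) fun b =>
      zsign (p ⬝ᵥ b) • (K b ψ - graphState G b • junk)‖ =
      ‖stack (splitQubits ι) ((fun b => K b ψ) - fun b => graphState G b • junk)‖ :=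
    norm_stack_congr (splitQubits ι) (Equiv.refl _) (fun b => zsign (p ⬝ᵥ b))
      (fun _ => norm_zsign _) _ _ fun _ => rfl
  rw [hΦ, hΦ, hΦ, tensor_eq_stack, tensor_eq_stack, ← stack_sub, ← stack_sub, ← stack_sub, ← hphase]
  refine le_of_eq_of_le ?_ (norm_add_le _ _)
  rw [← stack_add]
  refine norm_stack_congr (splitQubits ι) (Equiv.addRight q) (fun _ => 1) (fun _ => norm_one) _ _
    fun b => ?_
  simp only [Pi.sub_apply, Pi.add_apply, mul_apply_eq_comp, one_smul, Equiv.coe_addRight]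
  rw [opPow_pauliX_apply, opPow_pauliZ_apply,
    show K b (opPow X q (opPow Z p ψ)) = K (b + q) (opPow Z p ψ) from
      opProd_swapKraus_opPow hX b q _]
  module

end Extraction

section Constants

theorem sqrt_add_sqrt_le_delta {V : Type*} [Fintype V] (G : SimpleGraph V)
    [DecidableRel G.Adj] {ε : ℝ} (hε : 0 < ε) (p : V → ZMod 2) :
    Real.sqrt (2 * (2 * bitDot p p * Real.sqrt (2 * ε))) +
      Real.sqrt (14 * Fintype.card V * Real.sqrt (2 * ε)) ≤ delta G ε p := by
  have ht : Real.sqrt (2 * ε) = ((2 * ε) ^ (1 / 4 : ℝ)) ^ 2 := by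
    rw [← Real.rpow_natCast, ← Real.rpow_mul (by positivity), Real.sqrt_eq_rpow]
    norm_num
  rw [ht, delta]
  set t := (2 * ε) ^ (1 / 4 : ℝ)
  have ht0 : 0 ≤ t := by positivity
  set n : ℝ := (Fintype.card V : ℝ)
  have hn0 : 0 ≤ n := by positivity
  have h1 : Real.sqrt (2 * (2 * bitDot p p * t ^ 2)) = 2 * Real.sqrt (bitDot p p) * t := by
    rw [show 2 * (2 * (bitDot p p : ℝ) * t ^ 2) = (2 * t) ^ 2 * bitDot p p by ring,
      Real.sqrt_mul (by positivity), Real.sqrt_sq (by positivity)]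
    ring
  have h2 : Real.sqrt (14 * n * t ^ 2) = Real.sqrt (14 * n) * t := by
    rw [Real.sqrt_mul (by positivity), Real.sqrt_sq ht0]
  have h3 : Real.sqrt (14 * n) ≤
      2 * Real.sqrt (2 * n) + Real.sqrt (G.edgeFinset.card + n) := by
    have h4 : Real.sqrt n ≤ Real.sqrt (G.edgeFinset.card + n) :=
      Real.sqrt_le_sqrt (by linarith [Nat.cast_nonneg (α := ℝ) G.edgeFinset.card])
    have h5 : Real.sqrt (14 * n) ≤ 2 * Real.sqrt (2 * n) + Real.sqrt n := by
      refine Real.sqrt_le_iff.2 ⟨by positivity, ?_⟩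
      -- `14 ≤ (2 √2 + 1)²`, since `5 / 4 ≤ √2`.
      have h6 : Real.sqrt (2 * n) = Real.sqrt 2 * Real.sqrt n := Real.sqrt_mul (by norm_num) _
      have h7 : (5 / 4 : ℝ) ≤ Real.sqrt 2 := Real.le_sqrt_of_sq_le (by norm_num)
      have h8 := Real.sq_sqrt hn0
      have h9 : Real.sqrt 2 ^ 2 = 2 := Real.sq_sqrt (by norm_num)
      have h10 : (2 * Real.sqrt (2 * n) + Real.sqrt n) ^ 2 = (9 + 4 * Real.sqrt 2) * n := by
        rw [h6]
        linear_combination (9 + 4 * Real.sqrt 2) * h8 + 4 * Real.sqrt n ^ 2 * h9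
      rw [h10]
      nlinarith
    linarith
  rw [h1, h2]
  nlinarith

end Constants

/-! ### Observables in the `XZ` plane -/

section Plane

variable {V : Type*} [Fintype V] [DecidableEq V] {G : SimpleGraph V} [DecidableRel G.Adj]
  {ι : V → Type*} {X Z : ∀ v, L2 (ι v) →L[ℂ] L2 (ι v)} {ψ : Joint ι}

/-- If an isometry carries the operators on the neighbourhood of `v` to their ideal counterparts
up to `d`, then an observable at `v` that is correlated with them is carried to the ideal one. -/
theorem norm_sub_xzPlane_le {κ : V → Type*} (hψ : ‖ψ‖ = 1)
    (Φ : Joint ι →ₗᵢ[ℂ] Joint fun v => κ v × ZMod 2) {junk : Joint κ} (hj : ‖junk‖ = 1) {ε d : ℝ}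
    {u v : V} (huv : G.Adj u v)
    (hcos : ‖Φ (opPow Z (nbrBits G (bit v)) ψ) - tensor junk
      (opPow (fun _ => pauliZ) (nbrBits G (bit v)) (graphState G))‖ ≤ d)
    (hsin : ‖Φ (siteOp u (X u) (opPow Z (nbrBits G (bit u) + bit v) ψ)) - tensor junk
      (siteOp u pauliX (opPow (fun _ => pauliZ) (nbrBits G (bit u) + bit v) (graphState G)))‖ ≤ d)
    (θ : ℝ) {R : L2 (ι v) →L[ℂ] L2 (ι v)} (hR : IsPMObservable R)
    (hcorr : 1 - ε ≤ expect ψ (siteOp v R * ((Real.cos θ : ℂ) • opPow Z (nbrBits G (bit v)) +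
      (Real.sin θ : ℂ) • (siteOp u (X u) * opPow Z (nbrBits G (bit u) + bit v))))) :
    ‖Φ (siteOp v R ψ) - tensor junk (siteOp v (xzPlane θ) (graphState G))‖ ≤
      Real.sqrt (2 * (ε + 2 * d)) := by
  have hRψ : ‖Φ (siteOp v R ψ)‖ = 1 := by rw [Φ.norm_map, hR.siteOp.norm_apply, hψ]
  refine norm_sub_le_sqrt_of_unit hRψ ?_ ?_
  · rw [norm_tensor, hj,
      (IsPMObservable.siteOp (ι := fun _ : V => ZMod 2) (xzPlane_isPMObservable θ)).norm_apply,
      norm_graphState, one_mul]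
  rw [siteOp_xzPlane_graphState G huv]
  set c : ℂ := (Real.cos θ : ℂ)
  set s : ℂ := (Real.sin θ : ℂ)
  have hc : ‖c‖ ≤ 1 := by
    rw [Complex.norm_real]
    exact Real.abs_cos_le_one θ
  have hs : ‖s‖ ≤ 1 := by
    rw [Complex.norm_real]
    exact Real.abs_sin_le_one θ
  set a := opPow Z (nbrBits G (bit v)) ψ
  set b := siteOp u (X u) (opPow Z (nbrBits G (bit u) + bit v) ψ)
  set a' := opPow (fun _ => pauliZ) (nbrBits G (bit v)) (graphState G)
  set b' := siteOp u pauliX (opPow (fun _ => pauliZ) (nbrBits G (bit u) + bit v) (graphState G))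
  have h1 : inner ℂ (Φ (siteOp v R ψ)) (tensor junk (c • a' + s • b')) =
      inner ℂ ψ (siteOp v R (c • a + s • b)) - inner ℂ (Φ (siteOp v R ψ))
        (c • (Φ a - tensor junk a') + s • (Φ b - tensor junk b')) := by
    rw [← hR.siteOp.inner_left, ← Φ.inner_map_map, ← inner_sub_right]
    congr 1
    rw [tensor_add, tensor_smul, tensor_smul, map_add, map_smul, map_smul]
    module
  have h2 : (inner ℂ (Φ (siteOp v R ψ))
      (c • (Φ a - tensor junk a') + s • (Φ b - tensor junk b'))).re ≤ 2 * d := by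
    refine (Complex.re_le_norm _).trans ((norm_inner_le_norm _ _).trans ?_)
    rw [hRψ, one_mul]
    refine (norm_add_le _ _).trans ?_
    rw [norm_smul, norm_smul]
    have h3 := mul_le_mul hc hcos (norm_nonneg _) zero_le_one
    have h4 := mul_le_mul hs hsin (norm_nonneg _) zero_le_one
    linarith
  have h5 : 1 - ε ≤ (inner ℂ ψ (siteOp v R (c • a + s • b))).re := hcorr
  rw [h1, Complex.sub_re]
  linarith

end Plane

end GraphSelfTest

theorem mainTheorem3 {V : Type u} [Fintype V] [DecidableEq V] (G : SimpleGraph V)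
    [DecidableRel G.Adj] (hG : ∀ v, ∃ T : Finset V, v ∈ T ∧ G.IsNClique 3 T)
    {ι : V → Type w} (ψ : Joint ι) (hψ : ‖ψ‖ = 1)
    (X Z : ∀ v, L2 (ι v) →L[ℂ] L2 (ι v))
    (hX : ∀ v, IsPMObservable (X v)) (hZ : ∀ v, IsPMObservable (Z v))
    (ε : ℝ) (hε : 0 < ε)
    (hstab : ∀ v, 1 - ε ≤ expect ψ
      (siteOp v (X v) *
        opPow Z (nbrBits G (bit v))))
    (htri : ∀ T : Finset V, G.IsNClique 3 T → 1 - ε ≤ -expect ψ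
      (opPow X (indicatorBits T) *
        opPow Z (nbrBits G (indicatorBits T)))) :
    ∃ (J : V → Type w) (Φ : Joint ι →ₗᵢ[ℂ] Joint fun v => J v × ZMod 2)
      (junk : Joint J),
      IsLocalIsometry Φ ∧ ‖junk‖ = 1 ∧
      (∀ p q : V → ZMod 2,
        ‖Φ ((opPow X q * opPow Z p) ψ) -
          tensor junk
            ((opPow (fun _ => pauliX) q *
              opPow (fun _ => pauliZ) p)
              (graphState G))‖ ≤ delta G ε p) ∧
      ∀ u v, G.Adj u v → ∀ (θ : ℝ) (R : L2 (ι v) →L[ℂ] L2 (ι v)),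
        IsPMObservable R →
        1 - ε ≤ expect ψ
          (siteOp v R *
            ((Real.cos θ : ℂ) • opPow Z
                (nbrBits G (bit v)) +
              (Real.sin θ : ℂ) • (siteOp u (X u) *
                opPow Z (nbrBits G (bit u) +
                  bit v)))) →
        ‖Φ (siteOp v R ψ) -
          tensor junk
            (siteOp v (xzPlane θ) (graphState G))‖ ≤
          Real.sqrt (2 * (ε + 2 * max
            (delta G ε (nbrBits G (bit v)))
            (delta G ε (nbrBits G (bit u) +
              bit v)))) := by
  have hη : 0 ≤ Real.sqrt (2 * ε) := Real.sqrt_nonneg _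
  have hXZ : ∀ p q : V → ZMod 2, ‖(opPow X q * opPow Z p) ψ‖ = 1 := fun p q => by
    rw [mul_apply_eq_comp, (IsPMObservable.opPow hX q).norm_apply,
      (IsPMObservable.opPow hZ p).norm_apply, hψ]
  have hS : ∀ v, ‖(siteOp v (X v) * opPow Z (nbrBits G (bit v))) ψ - ψ‖ ≤ Real.sqrt (2 * ε) := by
    intro v
    rw [norm_sub_rev]
    refine norm_sub_le_sqrt_of_unit hψ ?_ (hstab v)
    rw [← opPow_bit]
    exact hXZ _ _
  have hT : ∀ T : Finset V, G.IsNClique 3 T →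
      ‖(opPow X (indicatorBits T) * opPow Z (nbrBits G (indicatorBits T))) ψ + ψ‖ ≤
        Real.sqrt (2 * ε) := by
    intro T hT
    have h := norm_sub_le_sqrt_of_unit hψ ((norm_neg _).trans (hXZ _ _)) (c := ε)
      (b := -(opPow X (indicatorBits T) * opPow Z (nbrBits G (indicatorBits T))) ψ) (by
        rw [inner_neg_right, Complex.neg_re]
        exact htri T hT)
    rwa [sub_neg_eq_add, add_comm] at h
  have hanti := norm_anticommutator_le hG hX hZ hS hT
  have hstab' : ∀ v, ‖siteOp v (X v) ψ - opPow Z (nbrBits G (bit v)) ψ‖ ≤ Real.sqrt (2 * ε) := by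
    intro v
    rw [← (hX v).siteOp.norm_apply, map_sub, (hX v).siteOp.apply_apply, norm_sub_rev]
    exact hS v
  obtain ⟨junk, hj, hjunk⟩ := exists_junk G hψ hX hZ hη hanti hstab'
  have hmain : ∀ p q : V → ZMod 2, ‖swapIsometry hX hZ ((opPow X q * opPow Z p) ψ) - tensor junk
      ((opPow (fun _ => pauliX) q * opPow (fun _ => pauliZ) p) (graphState G))‖ ≤ delta G ε p :=
    fun p q => (norm_swapIsometry_sub_le G hX hZ junk p q).trans
      ((add_le_add (norm_swapIsometry_opPow_sub_le hψ hX hZ hanti p) hjunk).trans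
        (sqrt_add_sqrt_le_delta G hε p))
  refine ⟨ι, swapIsometry hX hZ, junk, swapIsometry_isLocal hX hZ, hj, hmain, ?_⟩
  intro u v huv θ R hR hcorr
  refine norm_sub_xzPlane_le hψ _ hj huv ?_ ?_ θ hR hcorr
  · have h := hmain (nbrBits G (bit v)) 0
    rw [opPow_zero, opPow_zero, one_mul, one_mul] at h
    exact h.trans (le_max_left _ _)
  · have h := hmain (nbrBits G (bit u) + bit v) (bit u)
    rw [opPow_bit, opPow_bit] at h
    exact h.trans (le_max_right _ _)
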